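/- Let $f,g:\mathbb R\to\mathbb R$ be of class $C^2$, and let $u_0$ be a non-constant $\tau_0$-periodic solution ($\tau_0>0$) of the Liénard equation $\ddot u+f(u)\dot u+g(u)=0$ with $u_0(0)=a$, $\dot u_0(0)=0$, whose closed orbit $\Gamma=\{(u_0(t),\dot u_0(t)):t\in\mathbb R\}$ lies in the disc $S=\{(u,v)\in\mathbb R^2:u^2+v^2<r^2\}$. Assume $$\int_0^{\tau_0} f(u_0(t))\,dt>0 .$$ Let $e,T>0$ and let $\gamma(u,v,\varepsilon,\tau)$ be a real function of class $C^2$ for $(u,v)\in S$, $|\varepsilon|<e$, $|\tau-\tau_0|<T$. Solutions below are twice differentiable, defined on all of $\mathbb R$, and have phase curve $(u,\dot u)$ in $S$; a period need not be the least one. Then there are constants $0<\varepsilon_0<e$ and $0<\tau_1<\tau_0/2$, $\tau_1\le T$, an open set $N$ with $\Gamma\subset N\subset S$, and functions $\tau,h:\mathbb{R}\to\mathbb R$ with $\tau(0)=\tau_0$ and $h(0)=0$, such that for every $\varepsilon\in[-\varepsilon_0,\varepsilon_0]$ one has $|\tau(\varepsilon)-\tau_0|<\tau_1$ and the following holds.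 1. The equation $$\ddot u+f(u)\dot u+g(u)=\varepsilon\,\gamma(u,\dot u,\varepsilon,\tau)\qquad(\ast)$$ with $\tau=\tau(\varepsilon)$ has a non-constant periodic solution $u(\cdot,\varepsilon)$ of period $\tau(\varepsilon)$, with $u(0,\varepsilon)=a+h(\varepsilon)$, $\dot u(0,\varepsilon)=0$, and phase curve contained in $N$. 2. This solution is unique near $\Gamma$: if $|\tau'-\tau_0|<\tau_1$ and $w$ is a non-constant $\tau'$-periodic solution of $(\ast)$ with $\tau=\tau'$ whose phase curve meets $N$, then $\tau'=\tau(\varepsilon)$ and $w$ is a time translate of $u(\cdot,\varepsilon)$. -/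

import Mathlib

/-- The open disc `u² + v² < r²` of the phase plane with coordinates `(u, v) = (u, u')`. -/
def phaseDisc (r : ℝ) : Set (ℝ × ℝ) := {x | x.1 ^ 2 + x.2 ^ 2 < r ^ 2}

/-- `u` is a twice differentiable solution on all of `ℝ`, with phase curve `(u, u')` in `S`, of
`u'' + f(u) u' + g(u) = P(u, u')`. -/
structure IsLienardSolution (f g : ℝ → ℝ) (P : ℝ → ℝ → ℝ) (S : Set (ℝ × ℝ)) (u : ℝ → ℝ) :
    Prop where
  differentiable : Differentiable ℝ u
  differentiable_deriv : Differentiable ℝ (deriv u)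
  mem : ∀ t, (u t, deriv u t) ∈ S
  equation : ∀ t, deriv (deriv u) t + f (u t) * deriv u t + g (u t) = P (u t) (deriv u t)

/-- A non-constant function with period `T > 0` (not necessarily the least one). -/
def IsNonconstantPeriodic (u : ℝ → ℝ) (T : ℝ) : Prop :=
  0 < T ∧ Function.Periodic u T ∧ ¬ ∃ c, ∀ t, u t = c

/-!
Write the equation as a planar system for `(u, v) = (u, u')`. The closed orbit `Γ` crosses the
`u`-axis at `(a, 0)` with velocity `(0, -g a)`, and `g a ≠ 0` since otherwise `u₀` would be constant.
Let `Φ(ξ, τ)` be the point reached after the time `τ` by the solution of the equation with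
parameters `ε`, `τ` that starts at `(a + ξ, 0)`. Periodic solutions near `Γ` of period `τ` near `τ₀`
correspond to the solutions `(ξ, τ)` near `(0, τ₀)` of `Φ(ξ, τ) = (a + ξ, 0)`.

At `ε = 0` the monodromy matrix of `Γ` fixes the velocity `(0, -g a)`, and its determinant is
`exp (-∫ f) < 1` by Liouville's formula. Hence, up to Lipschitz errors that are small near `(0, τ₀)`,
`Φ₁ - a` is `exp (-∫ f) ξ` and `Φ₂` is a Lipschitz function of `ξ` minus `g a (τ - τ₀)`
(`IsPerturbedOrbit.return_estimate`). So `(ξ, τ) ↦ (Φ₁ - a, τ + Φ₂ / g a)` is a contraction in a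
suitably scaled norm (`IsPerturbedOrbit.exists_contraction`), which gives existence and uniqueness of
the fixed point (`IsPerturbedOrbit.exists_unique_return`). Differentiability of the flow is not
needed: for the difference `d` of two solutions, the Wronskian of `d` and the velocity of `Γ`
satisfies Liouville's equation up to a small error (`exists_wronskian_estimate`), and all other
estimates are Grönwall's inequality.

To have global solutions, the equation is replaced by one with bounded, globally Lipschitz
right-hand side that agrees with it near `Γ` (`exists_truncation`). A solution of the original
equation that meets a small neighbourhood `N` of `Γ` follows `Γ` for two periods; if its period is
near `τ₀`, it therefore stays near `Γ` for all time and solves the truncated equation. It crosses the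
`u`-axis near `(a, 0)` (`IsPerturbedOrbit.exists_crossing`), and after a shift of time it is one of
the solutions to which the uniqueness of the fixed point applies.
-/

open Set Metric Function
open scoped NNReal Topology

/-! ### Lipschitz vector fields and their solutions -/

/-- A real function that is Lipschitz on a compact set extends to a bounded Lipschitz function:
extend it, and cut the extension off at the bound on the compact set. -/
theorem LipschitzOnWith.exists_bounded_extension {α : Type*} [PseudoMetricSpace α] {s : Set α}
    (hs : IsCompact s) {F : α → ℝ} {L : ℝ≥0} (hF : LipschitzOnWith L F s) :
    ∃ G : α → ℝ, LipschitzWith L G ∧ (∃ M, ∀ x, |G x| ≤ M) ∧ EqOn F G s := by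
  obtain ⟨G, hG, hFG⟩ := hF.extend_real
  obtain ⟨M, hM⟩ := hs.exists_bound_of_continuousOn hF.continuousOn
  refine ⟨fun x => max (-|M|) (min |M| (G x)), (hG.const_min _).const_max _,
    ⟨|M|, fun x => abs_le.2 ⟨le_max_left _ _, max_le ?_ (min_le_left _ _)⟩⟩, ?_⟩
  · exact (neg_nonpos.2 (abs_nonneg M)).trans (abs_nonneg M)
  · intro x hx
    have h := abs_le.1 ((hM x hx).trans (le_abs_self M))
    change F x = max (-|M|) (min |M| (G x))
    rw [← hFG hx, min_eq_right h.2, max_eq_right h.1]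

section ODE

variable {E : Type*} [NormedAddCommGroup E] [NormedSpace ℝ E]

/-- Two global solutions of an autonomous Lipschitz equation that agree at one time are equal. -/
theorem LipschitzWith.solution_unique {X : E → E} {L : ℝ≥0} (hX : LipschitzWith L X) {x y : ℝ → E}
    (hx : ∀ t, HasDerivAt x (X (x t)) t) (hy : ∀ t, HasDerivAt y (X (y t)) t) {t₀ : ℝ}
    (h : x t₀ = y t₀) : x = y :=
  ODE_solution_unique_univ (v := fun _ => X) (s := fun _ => univ) (K := L)
    (fun _ => hX.lipschitzOnWith) (fun t => ⟨hx t, mem_univ _⟩) (fun t => ⟨hy t, mem_univ _⟩) h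

theorem hasDerivAt_comp_add_solution {X : E → E} {x : ℝ → E}
    (hx : ∀ t, HasDerivAt x (X (x t)) t) (s t : ℝ) :
    HasDerivAt (fun t => x (s + t)) (X (x (s + t))) t :=
  (hx (s + t)).comp_const_add s t

/-- A solution of an autonomous Lipschitz equation that returns to its initial value is
periodic. -/
theorem LipschitzWith.periodic_of_return {X : E → E} {L : ℝ≥0} (hX : LipschitzWith L X) {x : ℝ → E}
    (hx : ∀ t, HasDerivAt x (X (x t)) t) {T : ℝ} (h : x T = x 0) : Periodic x T := by
  have := hX.solution_unique (hasDerivAt_comp_add_solution hx T) hx (t₀ := 0) (by simpa using h)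
  intro t
  rw [add_comm]
  exact congrFun this t

/-- A bounded Lipschitz vector field has global solutions. -/
theorem LipschitzWith.exists_global_solution [CompleteSpace E] {X : E → E} {L : ℝ≥0} {M : ℝ}
    (hX : LipschitzWith L X) (hM : ∀ x, ‖X x‖ ≤ M) (x₀ : E) :
    ∃ x : ℝ → E, x 0 = x₀ ∧ ∀ t, HasDerivAt x (X (x t)) t := by
  lift M to ℝ≥0 using (norm_nonneg _).trans (hM x₀)
  have key : ∀ n : ℕ, ∃ x : ℝ → E, x 0 = x₀ ∧
      ∀ t ∈ Ioo (-(n + 1) : ℝ) (n + 1), HasDerivAt x (X (x t)) t := by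
    intro n
    have hn : (0 : ℝ) ≤ n + 1 := by positivity
    have hpl : IsPicardLindelof (fun _ => X) (tmin := -(n + 1)) (tmax := n + 1)
        ⟨0, by constructor <;> linarith⟩ x₀ (M * (n + 1)) 0 M L :=
      { lipschitzOnWith := fun _ _ => hX.lipschitzOnWith
        continuousOn := fun _ _ => continuousOn_const
        norm_le := fun _ _ x _ => hM x
        mul_max_le := by simp }
    obtain ⟨x, hx0, hx⟩ := hpl.exists_eq_forall_mem_Icc_hasDerivWithinAt₀
    exact ⟨x, hx0, fun t ht => (hx t (Ioo_subset_Icc_self ht)).hasDerivAt (Icc_mem_nhds ht.1 ht.2)⟩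
  choose x hx0 hx using key
  have hagree : ∀ m n : ℕ, m ≤ n → EqOn (x m) (x n) (Ioo (-(m + 1) : ℝ) (m + 1)) := by
    intro m n hmn
    have hmn' : (m : ℝ) ≤ n := by exact_mod_cast hmn
    have hm0 : (0 : ℝ) ≤ m := by positivity
    refine ODE_solution_unique_of_mem_Ioo (v := fun _ => X) (s := fun _ => univ) (K := L) (t₀ := 0)
      (fun _ _ => hX.lipschitzOnWith) ⟨by linarith, by linarith⟩
      (fun t ht => ⟨hx m t ht, mem_univ _⟩) (fun t ht => ⟨hx n t ⟨?_, ?_⟩, mem_univ _⟩)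
      ((hx0 m).trans (hx0 n).symm)
    · linarith [ht.1]
    · linarith [ht.2]
  have hceil : ∀ t : ℝ, t ∈ Ioo (-((⌈|t|⌉₊ : ℕ) + 1) : ℝ) ((⌈|t|⌉₊ : ℕ) + 1) := by
    intro t
    have := abs_le.1 (Nat.le_ceil |t|)
    constructor <;> linarith
  refine ⟨fun t => x ⌈|t|⌉₊ t, by simp [hx0], fun t => ?_⟩
  refine (hx ⌈|t|⌉₊ t (hceil t)).congr_of_eventuallyEq ?_
  filter_upwards [Ioo_mem_nhds (hceil t).1 (hceil t).2] with s hs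
  rcases le_total ⌈|s|⌉₊ ⌈|t|⌉₊ with h | h
  · exact hagree _ _ h (hceil s)
  · exact (hagree _ _ h hs).symm

/-- Grönwall's inequality for two curves whose velocities differ by at most `K ‖x - y‖ + b`. -/
theorem norm_sub_le_exp_mul {x y x' y' : ℝ → E} {K b L : ℝ} (hK : 1 ≤ K)
    (hb : 0 ≤ b) (hx : ∀ t, HasDerivAt x (x' t) t) (hy : ∀ t, HasDerivAt y (y' t) t)
    (h : ∀ t ∈ Icc 0 L, ‖x' t - y' t‖ ≤ K * ‖x t - y t‖ + b) {t : ℝ} (ht : t ∈ Icc 0 L) :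
    ‖x t - y t‖ ≤ Real.exp (K * L) * (‖x 0 - y 0‖ + b) := by
  have hd : ∀ t, HasDerivAt (fun t => x t - y t) (x' t - y' t) t := fun t => (hx t).sub (hy t)
  have := norm_le_gronwallBound_of_norm_deriv_right_le (f := fun t => x t - y t) (a := 0) (b := L)
    (fun t _ => (hd t).continuousAt.continuousWithinAt)
    (fun t _ => (hd t).hasDerivWithinAt) le_rfl (fun t ht => h t (Ico_subset_Icc_self ht)) t ht
  refine this.trans ?_
  have hexp : Real.exp (K * (t - 0)) ≤ Real.exp (K * L) :=
    Real.exp_le_exp.2 (by rw [sub_zero]; exact mul_le_mul_of_nonneg_left ht.2 (by linarith))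
  have hKb : b / K ≤ b := div_le_self hb hK
  have h0 : 0 ≤ b / K := by positivity
  rw [gronwallBound_of_K_ne_0 (by linarith)]
  calc ‖x 0 - y 0‖ * Real.exp (K * (t - 0)) + b / K * (Real.exp (K * (t - 0)) - 1)
      ≤ ‖x 0 - y 0‖ * Real.exp (K * L) + b / K * Real.exp (K * L) := by
        gcongr
        linarith
    _ ≤ ‖x 0 - y 0‖ * Real.exp (K * L) + b * Real.exp (K * L) := by gcongr
    _ = _ := by ring

/-- A `C¹` map is strictly differentiable at the points of a compact set, uniformly. -/
theorem IsCompact.exists_uniform_linear_approx {F : Type*} [NormedAddCommGroup F] [NormedSpace ℝ F]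
    {Z : E → F} (hZ : ContDiff ℝ 1 Z) {Γ : Set E} (hΓ : IsCompact Γ) {η : ℝ} (hη : 0 < η) :
    ∃ ρ > 0, ∀ c ∈ Γ, ∀ x ∈ ball c ρ, ∀ y ∈ ball c ρ,
      ‖Z x - Z y - fderiv ℝ Z c (x - y)‖ ≤ η * ‖x - y‖ := by
  have hu := hΓ.uniformContinuousAt_of_continuousAt (fderiv ℝ Z)
    (fun _ _ => (hZ.continuous_fderiv one_ne_zero).continuousAt) (Metric.dist_mem_uniformity hη)
  obtain ⟨ρ, hρ, hρ'⟩ := Metric.mem_uniformity_dist.1 hu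
  refine ⟨ρ, hρ, fun c hc x hx y hy => ?_⟩
  refine (convex_ball c ρ).norm_image_sub_le_of_norm_fderiv_le' (𝕜 := ℝ)
    (fun z _ => (hZ.differentiable one_ne_zero).differentiableAt) (fun z hz => ?_) hy hx
  have h1 : dist (fderiv ℝ Z c) (fderiv ℝ Z z) < η :=
    hρ' (a := c) (b := z) (by rw [dist_comm]; exact hz) hc
  rw [← dist_eq_norm, dist_comm]
  exact h1.le

end ODE

/-- A contraction of a ball about the origin that moves the origin little has a fixed point. -/
theorem exists_fixedPoint_of_contraction {E : Type*} [NormedAddCommGroup E] [CompleteSpace E]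
    {T : E → E} {ρ q : ℝ} (hρ : 0 ≤ ρ)
    (hq0 : 0 ≤ q) (hq : q < 1)
    (hT : ∀ x ∈ closedBall (0 : E) ρ, ∀ y ∈ closedBall (0 : E) ρ, ‖T x - T y‖ ≤ q * ‖x - y‖)
    (h0 : ‖T 0‖ ≤ (1 - q) * ρ) : ∃ x ∈ closedBall (0 : E) ρ, T x = x := by
  have hmem0 : (0 : E) ∈ closedBall (0 : E) ρ := mem_closedBall_self hρ
  have hmaps : MapsTo T (closedBall 0 ρ) (closedBall 0 ρ) := by
    intro x hx
    have h1 := hT x hx 0 hmem0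
    rw [mem_closedBall_zero_iff] at hx ⊢
    rw [sub_zero] at h1
    have h2 : ‖T x‖ ≤ ‖T x - T 0‖ + ‖T 0‖ := by simpa using norm_add_le (T x - T 0) (T 0)
    nlinarith
  have hc : ContractingWith (.mk q hq0) (hmaps.restrict T _ _) := by
    refine ⟨by exact_mod_cast hq, LipschitzWith.of_dist_le_mul fun x y => ?_⟩
    rw [Subtype.dist_eq, Subtype.dist_eq, dist_eq_norm, dist_eq_norm]
    exact hT x x.2 y y.2
  obtain ⟨y, hy, hfix, -⟩ := hc.exists_fixedPoint' isClosed_closedBall.isComplete hmaps hmem0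
    (edist_ne_top _ _)
  exact ⟨y, hy, hfix⟩

/-! ### Families of vector fields close to an unperturbed one -/

/-- A family of bounded vector fields `X ε τ` that are perturbations of order `ε` of a field
`X 0 τ` not depending on `τ`: the unperturbed field is `K`-Lipschitz, and the perturbation
`X ε τ - X 0 τ` is bounded by `K |ε|` and is `K |ε|`-Lipschitz in the point and in `τ` jointly. -/
structure IsPerturbationFamily {E : Type*} [NormedAddCommGroup E] (X : ℝ → ℝ → E → E) (K : ℝ) :
    Prop where
  one_le : 1 ≤ K
  lipschitz : ∀ τ τ' x y, ‖X 0 τ x - X 0 τ' y‖ ≤ K * ‖x - y‖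
  close : ∀ ε τ x, ‖X ε τ x - X 0 τ x‖ ≤ K * |ε|
  increment : ∀ ε τ τ' x y,
    ‖(X ε τ x - X ε τ' y) - (X 0 τ x - X 0 τ' y)‖ ≤ K * |ε| * (‖x - y‖ + |τ - τ'|)
  bounded : ∀ ε τ, ∃ M, ∀ x, ‖X ε τ x‖ ≤ M

namespace IsPerturbationFamily

section

variable {E : Type*} [NormedAddCommGroup E] {X : ℝ → ℝ → E → E} {K : ℝ}

theorem norm_sub_le (hX : IsPerturbationFamily X K) {ε : ℝ} (hε : |ε| ≤ 1) (τ τ' : ℝ) (x y : E) :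
    ‖X ε τ x - X ε τ' y‖ ≤ 2 * K * ‖x - y‖ + K * |ε| * |τ - τ'| := by
  have hK := hX.one_le
  have h1 := hX.lipschitz τ τ' x y
  have h2 := hX.increment ε τ τ' x y
  have h3 := norm_add_le ((X ε τ x - X ε τ' y) - (X 0 τ x - X 0 τ' y)) (X 0 τ x - X 0 τ' y)
  rw [sub_add_cancel] at h3
  have h4 : K * |ε| * ‖x - y‖ ≤ K * 1 * ‖x - y‖ := by gcongr
  linarith

theorem lipschitzWith (hX : IsPerturbationFamily X K) {ε : ℝ} (hε : |ε| ≤ 1) (τ : ℝ) :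
    ∃ L : ℝ≥0, LipschitzWith L (X ε τ) := by
  have hK := hX.one_le
  refine ⟨.mk (2 * K) (by linarith), LipschitzWith.of_dist_le_mul fun x y => ?_⟩
  simpa [dist_eq_norm] using hX.norm_sub_le hε τ τ x y

theorem norm_sub_le_base (hX : IsPerturbationFamily X K) (ε τ τ' : ℝ) (x y : E) :
    ‖X ε τ x - X 0 τ' y‖ ≤ K * ‖x - y‖ + K * |ε| := by
  have h3 := norm_add_le (X ε τ x - X 0 τ x) (X 0 τ x - X 0 τ' y)
  rw [sub_add_sub_cancel] at h3
  linarith [hX.close ε τ x, hX.lipschitz τ τ' x y]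

end

variable {E : Type*} [NormedAddCommGroup E] [NormedSpace ℝ E] {X : ℝ → ℝ → E → E} {K : ℝ}

/-- A solution of the perturbed equation stays close to a solution of the unperturbed one. -/
theorem dist_unperturbed_le (hX : IsPerturbationFamily X K) {ε τ τ' L t : ℝ} {x y : ℝ → E}
    (hx : ∀ t, HasDerivAt x (X ε τ (x t)) t) (hy : ∀ t, HasDerivAt y (X 0 τ' (y t)) t)
    (ht : t ∈ Icc 0 L) :
    ‖x t - y t‖ ≤ Real.exp (K * L) * (‖x 0 - y 0‖ + K * |ε|) :=
  norm_sub_le_exp_mul hX.one_le (mul_nonneg (by linarith [hX.one_le]) (abs_nonneg ε)) hx hy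
    (fun t _ => hX.norm_sub_le_base ε τ τ' (x t) (y t)) ht

/-- Solutions depend on the initial value and on the parameter `τ` in a Lipschitz way, and the
Lipschitz constant in `τ` is of order `ε`. -/
theorem dist_le (hX : IsPerturbationFamily X K) {ε τ τ' L t : ℝ} (hε : |ε| ≤ 1) {x y : ℝ → E}
    (hx : ∀ t, HasDerivAt x (X ε τ (x t)) t) (hy : ∀ t, HasDerivAt y (X ε τ' (y t)) t)
    (ht : t ∈ Icc 0 L) :
    ‖x t - y t‖ ≤ Real.exp (2 * K * L) * (‖x 0 - y 0‖ + K * |ε| * |τ - τ'|) := by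
  have hK := hX.one_le
  exact norm_sub_le_exp_mul (by linarith) (by positivity) hx hy
    (fun t _ => hX.norm_sub_le hε τ τ' (x t) (y t)) ht

theorem exists_solution [CompleteSpace E] (hX : IsPerturbationFamily X K) {ε : ℝ} (hε : |ε| ≤ 1)
    (τ : ℝ) (x₀ : E) : ∃ x : ℝ → E, x 0 = x₀ ∧ ∀ t, HasDerivAt x (X ε τ (x t)) t := by
  obtain ⟨L, hL⟩ := hX.lipschitzWith hε τ
  obtain ⟨M, hM⟩ := hX.bounded ε τ
  exact hL.exists_global_solution hM x₀

end IsPerturbationFamily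

/-! ### Liouville's formula along a solution of the Liénard equation -/

/-- The vector field `(u, v) ↦ (v, -f(u) v - g(u))` of the Liénard equation. -/
def lienardField (f g : ℝ → ℝ) (y : ℝ × ℝ) : ℝ × ℝ := (y.2, -(f y.1 * y.2 + g y.1))

theorem contDiff_lienardField {f g : ℝ → ℝ} (hf : ContDiff ℝ 1 f) (hg : ContDiff ℝ 1 g) :
    ContDiff ℝ 1 (lienardField f g) :=
  contDiff_snd.prodMk
    (((hf.comp contDiff_fst).mul contDiff_snd).add (hg.comp contDiff_fst)).neg

theorem fderiv_lienardField {f g : ℝ → ℝ} (hf : ContDiff ℝ 1 f) (hg : ContDiff ℝ 1 g)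
    (y d : ℝ × ℝ) : fderiv ℝ (lienardField f g) y d =
      (d.2, -((deriv f y.1 * y.2 + deriv g y.1) * d.1 + f y.1 * d.2)) := by
  have hf' : HasFDerivAt (fun y : ℝ × ℝ => f y.1) _ y :=
    ((hf.differentiable one_ne_zero y.1).hasDerivAt.hasFDerivAt).comp y
      (hasFDerivAt_fst (𝕜 := ℝ) (E := ℝ) (F := ℝ) (p := y))
  have hg' : HasFDerivAt (fun y : ℝ × ℝ => g y.1) _ y :=
    ((hg.differentiable one_ne_zero y.1).hasDerivAt.hasFDerivAt).comp y
      (hasFDerivAt_fst (𝕜 := ℝ) (E := ℝ) (F := ℝ) (p := y))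
  have hsnd := hasFDerivAt_snd (𝕜 := ℝ) (E := ℝ) (F := ℝ) (p := y)
  have h : HasFDerivAt (lienardField f g) _ y := hsnd.prodMk ((hf'.mul hsnd).add hg').neg
  rw [h.fderiv]
  ext <;> simp
  ring

theorem hasDerivAt_fst_comp {x : ℝ → ℝ × ℝ} {x' : ℝ × ℝ} {t : ℝ} (h : HasDerivAt x x' t) :
    HasDerivAt (fun t => (x t).1) x'.1 t :=
  (hasFDerivAt_fst (𝕜 := ℝ) (E := ℝ) (F := ℝ)).comp_hasDerivAt t h

theorem hasDerivAt_snd_comp {x : ℝ → ℝ × ℝ} {x' : ℝ × ℝ} {t : ℝ} (h : HasDerivAt x x' t) :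
    HasDerivAt (fun t => (x t).2) x'.2 t :=
  (hasFDerivAt_snd (𝕜 := ℝ) (E := ℝ) (F := ℝ)).comp_hasDerivAt t h

/-- Liouville's formula, with an error term. If `d` solves the linearization of the Liénard
equation along `x₀` up to an error `B`, then its Wronskian `W` with the solution
`z = (u₀', u₀'')` satisfies `W' = -f(u₀) W` up to a multiple of `B`. -/
theorem exists_wronskian_estimate {f g : ℝ → ℝ} (hf : ContDiff ℝ 1 f) (hg : ContDiff ℝ 1 g)
    {x₀ : ℝ → ℝ × ℝ} (hx₀ : ∀ t, HasDerivAt x₀ (lienardField f g (x₀ t)) t) {T : ℝ} (hT : 0 ≤ T) :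
    ∃ C, 0 ≤ C ∧ ∀ (d d' : ℝ → ℝ × ℝ) (B : ℝ), (∀ t, HasDerivAt d (d' t) t) →
      (∀ t ∈ Icc 0 T, ‖d' t - fderiv ℝ (lienardField f g) (x₀ t) (d t)‖ ≤ B) →
      |Real.exp (∫ t in (0 : ℝ)..T, f (x₀ t).1) *
          ((d T).1 * (lienardField f g (x₀ T)).2 - (d T).2 * (lienardField f g (x₀ T)).1) -
        ((d 0).1 * (lienardField f g (x₀ 0)).2 - (d 0).2 * (lienardField f g (x₀ 0)).1)|
        ≤ C * B := by
  have hx₀c : Continuous x₀ := continuous_iff_continuousAt.2 fun t => (hx₀ t).continuousAt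
  set c : ℝ → ℝ := fun t => f (x₀ t).1 with hc
  have hcc : Continuous c := hf.continuous.comp (continuous_fst.comp hx₀c)
  set I : ℝ → ℝ := fun t => ∫ s in (0 : ℝ)..t, c s with hI
  have hI' : ∀ t, HasDerivAt I (c t) t := fun t =>
    intervalIntegral.integral_hasDerivAt_right (hcc.intervalIntegrable _ _)
      (hcc.stronglyMeasurableAtFilter _ _) hcc.continuousAt
  have hIc : Continuous I := continuous_iff_continuousAt.2 fun t => (hI' t).continuousAt
  set z : ℝ → ℝ × ℝ := fun t => lienardField f g (x₀ t) with hz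
  have hZ := contDiff_lienardField hf hg
  have hz' : ∀ t, HasDerivAt z (fderiv ℝ (lienardField f g) (x₀ t) (z t)) t := fun t =>
    ((hZ.differentiable one_ne_zero (x₀ t)).hasFDerivAt).comp_hasDerivAt t (hx₀ t)
  have hzc : Continuous z := continuous_iff_continuousAt.2 fun t => (hz' t).continuousAt
  obtain ⟨C₁, hC₁⟩ := isCompact_Icc.exists_bound_of_continuousOn (s := Icc 0 T)
    ((Real.continuous_exp.comp hIc).continuousOn)
  obtain ⟨C₂, hC₂⟩ := isCompact_Icc.exists_bound_of_continuousOn (s := Icc 0 T) hzc.continuousOn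
  have h0T : (0 : ℝ) ∈ Icc 0 T := ⟨le_rfl, hT⟩
  have hC₁0 : 0 ≤ C₁ := (norm_nonneg _).trans (hC₁ 0 h0T)
  have hC₂0 : 0 ≤ C₂ := (norm_nonneg _).trans (hC₂ 0 h0T)
  refine ⟨C₁ * (2 * C₂) * T, by positivity, fun d d' B hd hB => ?_⟩
  have hB0 : 0 ≤ B := (norm_nonneg _).trans (hB 0 h0T)
  set V : ℝ → ℝ := fun t => Real.exp (I t) * ((d t).1 * (z t).2 - (d t).2 * (z t).1) with hV
  set R : ℝ → ℝ × ℝ := fun t => d' t - fderiv ℝ (lienardField f g) (x₀ t) (d t) with hR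
  have hV' : ∀ t, HasDerivAt V (Real.exp (I t) * ((R t).1 * (z t).2 - (R t).2 * (z t).1)) t := by
    intro t
    have hd1 := hasDerivAt_fst_comp (hd t)
    have hd2 := hasDerivAt_snd_comp (hd t)
    have hz1 := hasDerivAt_fst_comp (hz' t)
    have hz2 := hasDerivAt_snd_comp (hz' t)
    have := (hI' t).exp.mul ((hd1.mul hz2).sub (hd2.mul hz1))
    refine this.congr_deriv ?_
    simp only [hR, fderiv_lienardField hf hg, Prod.fst_sub, Prod.snd_sub, Pi.mul_apply,
      Pi.sub_apply, hc]
    ring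
  have hbound : ∀ t ∈ Icc 0 T,
      ‖Real.exp (I t) * ((R t).1 * (z t).2 - (R t).2 * (z t).1)‖ ≤ C₁ * (2 * C₂ * B) := by
    intro t ht
    rw [norm_mul]
    refine mul_le_mul (hC₁ t ht) ?_ (norm_nonneg _) hC₁0
    have h1 : |(R t).1| ≤ B := (norm_fst_le (R t)).trans (hB t ht)
    have h2 : |(R t).2| ≤ B := (norm_snd_le (R t)).trans (hB t ht)
    have h3 : |(z t).1| ≤ C₂ := (norm_fst_le (z t)).trans (hC₂ t ht)
    have h4 : |(z t).2| ≤ C₂ := (norm_snd_le (z t)).trans (hC₂ t ht)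
    rw [Real.norm_eq_abs]
    refine (abs_sub _ _).trans ?_
    rw [abs_mul, abs_mul]
    have := mul_le_mul h1 h4 (abs_nonneg _) hB0
    have := mul_le_mul h2 h3 (abs_nonneg _) hB0
    linarith
  have := (convex_Icc (0 : ℝ) T).norm_image_sub_le_of_norm_hasDerivWithin_le
    (fun t _ => (hV' t).hasDerivWithinAt) hbound h0T ⟨hT, le_rfl⟩
  rw [sub_zero, Real.norm_eq_abs, Real.norm_of_nonneg hT] at this
  have hV0 : V 0 = (d 0).1 * (z 0).2 - (d 0).2 * (z 0).1 := by simp [hV, hI]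
  rw [hV0] at this
  refine this.trans (le_of_eq (by ring))

/-! ### The return estimate -/

/-- A periodic orbit `x₀`, through `(a, 0)`, of the planar system of the Liénard equation, together
with a perturbation family whose unperturbed member agrees with the Liénard field within
distance `δ` of the orbit. The integral of the divergence `-f` along the orbit is negative. -/
structure IsPerturbedOrbit (f g : ℝ → ℝ) (X : ℝ → ℝ → ℝ × ℝ → ℝ × ℝ) (K : ℝ) (x₀ : ℝ → ℝ × ℝ)
    (τ₀ a δ : ℝ) : Prop where
  family : IsPerturbationFamily X K
  contDiff_f : ContDiff ℝ 1 f
  contDiff_g : ContDiff ℝ 1 g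
  period_pos : 0 < τ₀
  radius_pos : 0 < δ
  solution : ∀ t, HasDerivAt x₀ (lienardField f g (x₀ t)) t
  periodic : Periodic x₀ τ₀
  initial : x₀ 0 = (a, 0)
  g_ne_zero : g a ≠ 0
  eq_lienardField : ∀ τ t y, ‖y - x₀ t‖ < δ → X 0 τ y = lienardField f g y
  integral_pos : 0 < ∫ t in (0 : ℝ)..τ₀, f (x₀ t).1

namespace IsPerturbedOrbit

variable {f g : ℝ → ℝ} {X : ℝ → ℝ → ℝ × ℝ → ℝ × ℝ} {K : ℝ} {x₀ : ℝ → ℝ × ℝ} {τ₀ a δ : ℝ}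

theorem solution' (h : IsPerturbedOrbit f g X K x₀ τ₀ a δ) (τ t : ℝ) :
    HasDerivAt x₀ (X 0 τ (x₀ t)) t := by
  rw [h.eq_lienardField τ t (x₀ t) (by simpa using h.radius_pos)]
  exact h.solution t

theorem continuous (h : IsPerturbedOrbit f g X K x₀ τ₀ a δ) : Continuous x₀ :=
  continuous_iff_continuousAt.2 fun t => (h.solution t).continuousAt

/-- A solution of the perturbed equation that starts near a point of the orbit follows the orbit
for two periods. -/
theorem exists_dist_orbit_le (h : IsPerturbedOrbit f g X K x₀ τ₀ a δ) :
    ∃ G, 1 ≤ G ∧ ∀ (ε τ s : ℝ) (x : ℝ → ℝ × ℝ), (∀ t, HasDerivAt x (X ε τ (x t)) t) →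
      ∀ t ∈ Icc 0 (2 * τ₀), ‖x t - x₀ (s + t)‖ ≤ G * (‖x 0 - x₀ s‖ + |ε|) := by
  have hK := h.family.one_le
  have hτ := h.period_pos
  have hexp : 1 ≤ Real.exp (K * (2 * τ₀)) := Real.one_le_exp (by positivity)
  refine ⟨Real.exp (K * (2 * τ₀)) * K, one_le_mul_of_one_le_of_one_le hexp hK,
    fun ε τ s x hx t ht => ?_⟩
  have h1 := h.family.dist_unperturbed_le hx (hasDerivAt_comp_add_solution (h.solution' τ) s) ht
  rw [add_zero] at h1
  refine h1.trans ?_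
  rw [mul_assoc]
  have h2 : ‖x 0 - x₀ s‖ ≤ K * ‖x 0 - x₀ s‖ := le_mul_of_one_le_left (norm_nonneg _) hK
  gcongr
  linarith

set_option maxHeartbeats 1000000 in
/-- The time-`T` map of the perturbed equation along the transversal `v = 0`, as a function of the
abscissa `a + ξ` and of the time `T = τ` that also enters the equation as a parameter. Up to
arbitrarily small Lipschitz errors its first component has slope `exp (-∫ f) < 1` in `ξ`, by
Liouville's formula, and does not depend on `τ`, while the second component has slope `-g a`
in `τ`. -/
theorem return_estimate (h : IsPerturbedOrbit f g X K x₀ τ₀ a δ) :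
    ∃ D, 0 ≤ D ∧ ∀ σ > 0, ∃ ρ > 0, ∀ (ε ξ₁ ξ₂ τ₁ τ₂ : ℝ) (x₁ x₂ : ℝ → ℝ × ℝ),
      |ε| ≤ ρ → |ξ₁| ≤ ρ → |ξ₂| ≤ ρ → |τ₁ - τ₀| ≤ ρ → |τ₂ - τ₀| ≤ ρ →
      x₁ 0 = (a + ξ₁, 0) → x₂ 0 = (a + ξ₂, 0) →
      (∀ t, HasDerivAt x₁ (X ε τ₁ (x₁ t)) t) → (∀ t, HasDerivAt x₂ (X ε τ₂ (x₂ t)) t) →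
      |(x₁ τ₁).1 - (x₂ τ₂).1 - Real.exp (-∫ t in (0 : ℝ)..τ₀, f (x₀ t).1) * (ξ₁ - ξ₂)|
          ≤ σ * (|ξ₁ - ξ₂| + |τ₁ - τ₂|) ∧
        |(x₁ τ₁).2 - (x₂ τ₂).2 + g a * (τ₁ - τ₂)|
          ≤ D * |ξ₁ - ξ₂| + σ * (|ξ₁ - ξ₂| + |τ₁ - τ₂|) := by
  have hK := h.family.one_le
  have hτ := h.period_pos
  set Z := lienardField f g with hZ
  have hZ1 : ContDiff ℝ 1 Z := contDiff_lienardField h.contDiff_f h.contDiff_g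
  have hxτ : x₀ τ₀ = (a, 0) := by rw [← h.initial]; simpa using h.periodic 0
  have hZ0 : Z (x₀ 0) = (0, -g a) := by simp [hZ, h.initial, lienardField]
  have hZτ : Z (x₀ τ₀) = (0, -g a) := by simp [hZ, hxτ, lienardField]
  obtain ⟨G, hG, hnear⟩ := h.exists_dist_orbit_le
  obtain ⟨C, hC, hwron⟩ := exists_wronskian_estimate h.contDiff_f h.contDiff_g h.solution hτ.le
  set I := ∫ t in (0 : ℝ)..τ₀, f (x₀ t).1 with hI
  set C' := Real.exp (-I) * C / |g a| with hC'
  have hga : 0 < |g a| := abs_pos.2 h.g_ne_zero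
  have hC'0 : 0 ≤ C' := by positivity
  set D₀ := Real.exp (2 * K * (2 * τ₀)) with hD₀
  have hD₀0 : 0 < D₀ := Real.exp_pos _
  set D := D₀ * K with hD
  have hD0 : 0 < D := by positivity
  have hD₀D : D₀ ≤ D := le_mul_of_one_le_right hD₀0.le hK
  refine ⟨D, hD0.le, fun σ hσ => ?_⟩
  -- `η` bounds the error of the linearization of the field, `ρ` the size of all perturbations
  set η := σ / (4 * (C' * D + 1)) with hη
  have hη0 : 0 < η := by positivity
  have hησ : C' * D * η ≤ σ / 4 := by
    rw [hη, mul_div_assoc', div_le_div_iff₀ (by positivity) (by norm_num)]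
    nlinarith [mul_nonneg hC'0 hD0.le]
  obtain ⟨ρ₁, hρ₁, hlin⟩ := (isCompact_Icc.image h.continuous).exists_uniform_linear_approx hZ1 hη0
    (Γ := x₀ '' Icc 0 (2 * τ₀))
  obtain ⟨ρ₂, hρ₂, hcont⟩ := Metric.continuousAt_iff.1
    ((hZ1.continuous.comp h.continuous).continuousAt (x := τ₀)) (σ / 8) (by positivity)
  set M := C' * K * (D + 1) + (2 * K * D + K) + D + 2 * (K * (2 * G) + K) + 1 with hM
  have hM0 : 0 < M := by positivity
  set ρ := min (min (ρ₁ / (2 * G + 1)) (δ / (2 * G + 1))) (min (min (ρ₂ / 2) (σ / (4 * M)))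
    (min 1 τ₀)) with hρ
  have hρ0 : 0 < ρ := by have := h.radius_pos; positivity
  have hρρ₁ : 2 * G * ρ < ρ₁ := by
    have : ρ ≤ ρ₁ / (2 * G + 1) := (min_le_left _ _).trans (min_le_left _ _)
    rw [le_div_iff₀ (by positivity)] at this
    linarith
  have hρδ : 2 * G * ρ < δ := by
    have : ρ ≤ δ / (2 * G + 1) := (min_le_left _ _).trans (min_le_right _ _)
    rw [le_div_iff₀ (by positivity)] at this
    linarith
  have hρρ₂ : ρ < ρ₂ := by
    have : ρ ≤ ρ₂ / 2 := (min_le_right _ _).trans ((min_le_left _ _).trans (min_le_left _ _))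
    linarith
  have hρM : M * ρ ≤ σ / 4 := by
    have : ρ ≤ σ / (4 * M) := (min_le_right _ _).trans ((min_le_left _ _).trans (min_le_right _ _))
    rw [le_div_iff₀ (by positivity)] at this
    linarith
  have hρ1 : ρ ≤ 1 := (min_le_right _ _).trans ((min_le_right _ _).trans (min_le_left _ _))
  have hρτ : ρ ≤ τ₀ := (min_le_right _ _).trans ((min_le_right _ _).trans (min_le_right _ _))
  refine ⟨ρ, hρ0, fun ε ξ₁ ξ₂ τ₁ τ₂ x₁ x₂ hε hξ₁ hξ₂ hτ₁ hτ₂ hx₁0 hx₂0 hx₁ hx₂ => ?_⟩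
  have hε1 : |ε| ≤ 1 := hε.trans hρ1
  set S := |ξ₁ - ξ₂| + |τ₁ - τ₂| with hS
  have hS0 : 0 ≤ S := by positivity
  have hclose : ∀ (ξ τ : ℝ) (x : ℝ → ℝ × ℝ), |ξ| ≤ ρ → x 0 = (a + ξ, 0) →
      (∀ t, HasDerivAt x (X ε τ (x t)) t) → ∀ t ∈ Icc 0 (2 * τ₀), ‖x t - x₀ t‖ ≤ 2 * G * ρ := by
    intro ξ τ x hξ hx0 hx t ht
    have := hnear ε τ 0 x hx t ht
    rw [zero_add, hx0, h.initial] at this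
    have hn : ‖((a + ξ, 0) : ℝ × ℝ) - (a, 0)‖ = |ξ| := by simp [Prod.norm_def]
    rw [hn] at this
    nlinarith
  have hcl₁ := hclose ξ₁ τ₁ x₁ hξ₁ hx₁0 hx₁
  have hcl₂ := hclose ξ₂ τ₂ x₂ hξ₂ hx₂0 hx₂
  have hd0 : x₁ 0 - x₂ 0 = (ξ₁ - ξ₂, 0) := by rw [hx₁0, hx₂0]; ext <;> simp
  have hdist : ∀ t ∈ Icc 0 (2 * τ₀), ‖x₁ t - x₂ t‖ ≤ D₀ * (|ξ₁ - ξ₂| + K * |ε| * |τ₁ - τ₂|) := by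
    intro t ht
    have := h.family.dist_le hε1 hx₁ hx₂ ht
    rwa [hd0, show ‖((ξ₁ - ξ₂, 0) : ℝ × ℝ)‖ = |ξ₁ - ξ₂| by simp [Prod.norm_def]] at this
  have hdistS : ∀ t ∈ Icc 0 (2 * τ₀), ‖x₁ t - x₂ t‖ ≤ D * S := by
    intro t ht
    refine (hdist t ht).trans ?_
    rw [show D * S = D₀ * (K * |ξ₁ - ξ₂| + K * |τ₁ - τ₂|) by rw [hD, hS]; ring]
    have h1 : |ξ₁ - ξ₂| ≤ K * |ξ₁ - ξ₂| := le_mul_of_one_le_left (abs_nonneg _) hK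
    have h2 : K * |ε| * |τ₁ - τ₂| ≤ K * 1 * |τ₁ - τ₂| := by gcongr
    exact mul_le_mul_of_nonneg_left (by linarith) hD₀0.le
  have hmem : ∀ s, |s - τ₀| ≤ ρ → s ∈ Icc 0 (2 * τ₀) := fun s hs => by
    have := abs_le.1 hs
    constructor <;> linarith
  have hτmem : τ₀ ∈ Icc 0 (2 * τ₀) := hmem τ₀ (by simpa using hρ0.le)
  -- the first component of the difference at time `τ₀`, by Liouville's formula
  have hfirst : |(x₁ τ₀ - x₂ τ₀).1 - Real.exp (-I) * (ξ₁ - ξ₂)| ≤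
      C' * ((K * |ε| * (D + 1) + η * D) * S) := by
    have hw := hwron (fun t => x₁ t - x₂ t) (fun t => X ε τ₁ (x₁ t) - X ε τ₂ (x₂ t))
      ((K * |ε| * (D + 1) + η * D) * S) (fun t => (hx₁ t).sub (hx₂ t)) (by
        intro t ht
        have ht' : t ∈ Icc 0 (2 * τ₀) := ⟨ht.1, by linarith [ht.2]⟩
        have hi := h.family.increment ε τ₁ τ₂ (x₁ t) (x₂ t)
        rw [h.eq_lienardField τ₁ t (x₁ t) ((hcl₁ t ht').trans_lt hρδ),
          h.eq_lienardField τ₂ t (x₂ t) ((hcl₂ t ht').trans_lt hρδ)] at hi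
        have hl := hlin (x₀ t) (mem_image_of_mem _ ht') (x₁ t)
          (by rw [mem_ball, dist_eq_norm]; exact (hcl₁ t ht').trans_lt hρρ₁) (x₂ t)
          (by rw [mem_ball, dist_eq_norm]; exact (hcl₂ t ht').trans_lt hρρ₁)
        have hadd := norm_add_le (X ε τ₁ (x₁ t) - X ε τ₂ (x₂ t) - (Z (x₁ t) - Z (x₂ t)))
          (Z (x₁ t) - Z (x₂ t) - fderiv ℝ Z (x₀ t) (x₁ t - x₂ t))
        rw [sub_add_sub_cancel] at hadd
        have hdS := hdistS t ht'
        have hτS : |τ₁ - τ₂| ≤ S := le_add_of_nonneg_left (abs_nonneg _)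
        have h1 : K * |ε| * (‖x₁ t - x₂ t‖ + |τ₁ - τ₂|) ≤ K * |ε| * (D * S + S) := by gcongr
        have h2 : η * ‖x₁ t - x₂ t‖ ≤ η * (D * S) := by gcongr
        refine hadd.trans ((add_le_add (hi.trans h1) (hl.trans h2)).trans (le_of_eq (by ring))))
    rw [← hZ, hZ0, hZτ] at hw
    simp only [hd0, mul_zero, sub_zero] at hw
    have he : (x₁ τ₀ - x₂ τ₀).1 - Real.exp (-I) * (ξ₁ - ξ₂) =
        Real.exp (-I) / (-g a) * (Real.exp I * ((x₁ τ₀ - x₂ τ₀).1 * -g a) - (ξ₁ - ξ₂) * -g a) := by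
      have hne := h.g_ne_zero
      rw [Real.exp_neg]
      field_simp
      ring
    rw [he, abs_mul, abs_div, abs_neg, Real.abs_exp]
    refine (mul_le_mul_of_nonneg_left hw (by positivity)).trans (le_of_eq ?_)
    rw [hC']
    ring
  -- the difference hardly changes between the times `τ₀` and `τ₁`
  have hshift : ‖(x₁ τ₁ - x₂ τ₁) - (x₁ τ₀ - x₂ τ₀)‖ ≤ (2 * K * D + K) * S * ρ := by
    have := (convex_Icc 0 (2 * τ₀)).norm_image_sub_le_of_norm_hasDerivWithin_le
      (f := fun t => x₁ t - x₂ t) (C := (2 * K * D + K) * S)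
      (fun t _ => ((hx₁ t).sub (hx₂ t)).hasDerivWithinAt) (fun t ht => ?_) hτmem (hmem τ₁ hτ₁)
    · refine this.trans ?_
      gcongr
      exact hτ₁
    · have h1 := h.family.norm_sub_le hε1 τ₁ τ₂ (x₁ t) (x₂ t)
      have h2 : 2 * K * ‖x₁ t - x₂ t‖ ≤ 2 * K * (D * S) := by
        have := hdistS t ht
        gcongr
      have h3 : K * |ε| * |τ₁ - τ₂| ≤ K * 1 * S := by
        gcongr
        exact le_add_of_nonneg_left (abs_nonneg _)
      linarith
  -- near the time `τ₀` the velocity is almost `(0, -g a)`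
  have htime : ‖x₂ τ₁ - x₂ τ₂ - (τ₁ - τ₂) • ((0, -g a) : ℝ × ℝ)‖ ≤
      (σ / 8 + (K * (2 * G) + K) * ρ) * S := by
    have hder : ∀ t, HasDerivAt (fun t => x₂ t - t • ((0, -g a) : ℝ × ℝ))
        (X ε τ₂ (x₂ t) - (0, -g a)) t := fun t =>
      ((hx₂ t).sub ((hasDerivAt_id t).smul_const ((0, -g a) : ℝ × ℝ))).congr_deriv (by simp)
    have := (convex_closedBall τ₀ ρ).norm_image_sub_le_of_norm_hasDerivWithin_le
      (f := fun t => x₂ t - t • ((0, -g a) : ℝ × ℝ)) (C := σ / 8 + (K * (2 * G) + K) * ρ)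
      (fun t _ => (hder t).hasDerivWithinAt) (fun t ht => ?_)
      (x := τ₂) (y := τ₁) (mem_closedBall.2 hτ₂) (mem_closedBall.2 hτ₁)
    · have he : x₂ τ₁ - x₂ τ₂ - (τ₁ - τ₂) • ((0, -g a) : ℝ × ℝ) =
          x₂ τ₁ - τ₁ • ((0, -g a) : ℝ × ℝ) - (x₂ τ₂ - τ₂ • ((0, -g a) : ℝ × ℝ)) := by
        rw [sub_smul]; abel
      rw [he]
      refine this.trans ?_
      gcongr
      exact le_add_of_nonneg_left (abs_nonneg _)
    · rw [mem_closedBall, Real.dist_eq] at ht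
      have h1 := h.family.norm_sub_le_base ε τ₂ τ₂ (x₂ t) (x₀ t)
      rw [h.eq_lienardField τ₂ t (x₀ t) (by simpa using h.radius_pos), ← hZ] at h1
      have h2 : dist (Z (x₀ t)) (Z (x₀ τ₀)) < σ / 8 := hcont (ht.trans_lt hρρ₂)
      rw [hZτ, dist_eq_norm] at h2
      have h3 := norm_add_le (X ε τ₂ (x₂ t) - Z (x₀ t)) (Z (x₀ t) - (0, -g a))
      rw [sub_add_sub_cancel] at h3
      have h4 : K * ‖x₂ t - x₀ t‖ ≤ K * (2 * G * ρ) := by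
        have := hcl₂ t (hmem t ht)
        gcongr
      have h5 : K * |ε| ≤ K * ρ := by gcongr
      rw [show (K * (2 * G) + K) * ρ = K * (2 * G * ρ) + K * ρ by ring]
      linarith
  have htotal : ‖x₁ τ₁ - x₂ τ₂ - (x₁ τ₀ - x₂ τ₀) - (τ₁ - τ₂) • ((0, -g a) : ℝ × ℝ)‖ ≤
      (2 * K * D + K) * S * ρ + (σ / 8 + (K * (2 * G) + K) * ρ) * S := by
    have he : x₁ τ₁ - x₂ τ₂ - (x₁ τ₀ - x₂ τ₀) - (τ₁ - τ₂) • ((0, -g a) : ℝ × ℝ) =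
        ((x₁ τ₁ - x₂ τ₁) - (x₁ τ₀ - x₂ τ₀)) +
          (x₂ τ₁ - x₂ τ₂ - (τ₁ - τ₂) • ((0, -g a) : ℝ × ℝ)) := by abel
    rw [he]
    exact (norm_add_le _ _).trans (add_le_add hshift htime)
  have ht1 := (norm_fst_le _).trans htotal
  have ht2 := (norm_snd_le _).trans htotal
  simp only [Prod.fst_sub, Prod.snd_sub, Prod.smul_fst, Prod.smul_snd, smul_eq_mul, mul_zero,
    sub_zero, Real.norm_eq_abs, mul_neg, sub_neg_eq_add] at ht1 ht2 hfirst
  have hεM : ∀ c, 0 ≤ c → c * |ε| * S ≤ c * ρ * S := fun c hc => by gcongr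
  have hMS := mul_le_mul_of_nonneg_right hρM hS0
  have hησS := mul_le_mul_of_nonneg_right hησ hS0
  have hρS : 0 ≤ ρ * S := by positivity
  have hGρS : 0 ≤ (K * (2 * G) + K) * (ρ * S) := by positivity
  have hKDρS : 0 ≤ (2 * K * D + K) * (ρ * S) := by positivity
  have hDρS : 0 ≤ D * (ρ * S) := by positivity
  have hCρS : 0 ≤ C' * K * (D + 1) * (ρ * S) := by positivity
  have hσS : 0 ≤ σ * S := by positivity
  have hMS' : C' * K * (D + 1) * (ρ * S) + (2 * K * D + K) * (ρ * S) + D * (ρ * S) +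
      2 * ((K * (2 * G) + K) * (ρ * S)) + ρ * S ≤ σ / 4 * S := by
    refine le_trans (le_of_eq ?_) hMS
    rw [hM]
    ring
  constructor
  · have h1 := hεM (C' * K * (D + 1)) (by positivity)
    have h2 := abs_add_le ((x₁ τ₁).1 - (x₂ τ₂).1 - ((x₁ τ₀).1 - (x₂ τ₀).1))
      ((x₁ τ₀).1 - (x₂ τ₀).1 - Real.exp (-I) * (ξ₁ - ξ₂))
    rw [sub_add_sub_cancel] at h2
    refine h2.trans ((add_le_add ht1 hfirst).trans ?_)
    linarith
  · have h1 := hεM D hD0.le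
    have h2 := abs_add_le ((x₁ τ₁).2 - (x₂ τ₂).2 - ((x₁ τ₀).2 - (x₂ τ₀).2) + (τ₁ - τ₂) * g a)
      ((x₁ τ₀).2 - (x₂ τ₀).2)
    have h3 : |(x₁ τ₀).2 - (x₂ τ₀).2| ≤ D * |ξ₁ - ξ₂| + D * |ε| * S := by
      refine ((norm_snd_le (x₁ τ₀ - x₂ τ₀)).trans (hdist τ₀ hτmem)).trans ?_
      have h4 : D₀ * |ξ₁ - ξ₂| ≤ D * |ξ₁ - ξ₂| := by gcongr
      have h5 : D * |ε| * |τ₁ - τ₂| ≤ D * |ε| * S := by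
        gcongr
        exact le_add_of_nonneg_left (abs_nonneg _)
      have h6 : D₀ * (K * |ε| * |τ₁ - τ₂|) = D * |ε| * |τ₁ - τ₂| := by rw [hD]; ring
      rw [mul_add]
      linarith
    have he : (x₁ τ₁).2 - (x₂ τ₂).2 + g a * (τ₁ - τ₂) =
        (x₁ τ₁).2 - (x₂ τ₂).2 - ((x₁ τ₀).2 - (x₂ τ₀).2) + (τ₁ - τ₂) * g a +
          ((x₁ τ₀).2 - (x₂ τ₀).2) := by ring
    rw [he]
    refine h2.trans ((add_le_add ht2 h3).trans ?_)
    linarith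

/-! ### Periodic orbits near the unperturbed one -/

/-- The map `(ξ, τ) ↦ (Φ₁ - a, τ + Φ₂ / g a)`, with `Φ` the time-`τ` map at `(a + ξ, 0)`, contracts
the norm `max |ξ| (κ |τ|)` if `κ` is small enough to make the dependence of the second component
on `ξ` harmless. -/
theorem exists_contraction (h : IsPerturbedOrbit f g X K x₀ τ₀ a δ) :
    ∃ κ > 0, ∃ q, 0 ≤ q ∧ q < 1 ∧ ∃ ρ > 0, ∀ (ε ξ₁ ξ₂ τ₁ τ₂ : ℝ) (x₁ x₂ : ℝ → ℝ × ℝ),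
      |ε| ≤ ρ → |ξ₁| ≤ ρ → |ξ₂| ≤ ρ → |τ₁ - τ₀| ≤ ρ → |τ₂ - τ₀| ≤ ρ →
      x₁ 0 = (a + ξ₁, 0) → x₂ 0 = (a + ξ₂, 0) →
      (∀ t, HasDerivAt x₁ (X ε τ₁ (x₁ t)) t) → (∀ t, HasDerivAt x₂ (X ε τ₂ (x₂ t)) t) →
      |(x₁ τ₁).1 - (x₂ τ₂).1| ≤ q * max |ξ₁ - ξ₂| (κ * |τ₁ - τ₂|) ∧
        |κ * (τ₁ - τ₂) + κ / g a * ((x₁ τ₁).2 - (x₂ τ₂).2)|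
          ≤ q * max |ξ₁ - ξ₂| (κ * |τ₁ - τ₂|) := by
  obtain ⟨D, hD, hest⟩ := h.return_estimate
  set μ := Real.exp (-∫ t in (0 : ℝ)..τ₀, f (x₀ t).1) with hμ
  have hμ0 : 0 < μ := Real.exp_pos _
  have hμ1 : μ < 1 := by
    rw [hμ, Real.exp_lt_one_iff]
    linarith [h.integral_pos]
  have hga : 0 < |g a| := abs_pos.2 h.g_ne_zero
  set q := (1 + μ) / 2 with hq
  have hq0 : 0 < q := by positivity
  have hq1 : q < 1 := by rw [hq]; linarith
  set κ := |g a| * q / (2 * (D + 1)) with hκ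
  have hκ0 : 0 < κ := by positivity
  have hκD : κ / |g a| * D ≤ q / 2 := by
    rw [hκ, show |g a| * q / (2 * (D + 1)) / |g a| * D = q / 2 * (D / (D + 1)) by field_simp]
    exact mul_le_of_le_one_right (by positivity) ((div_le_one (by positivity)).2 (by linarith))
  set A := 1 + 1 / κ with hA
  have hA0 : 0 < A := by positivity
  set σ := min ((1 - μ) / 2 / A) (q / 2 / (κ / |g a| * A)) with hσ
  have hσ0 : 0 < σ := by
    have : 0 < 1 - μ := by linarith
    positivity
  have hσ1 : σ * A ≤ (1 - μ) / 2 := by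
    rw [← le_div_iff₀ hA0]
    exact min_le_left _ _
  have hσ2 : κ / |g a| * (σ * A) ≤ q / 2 := by
    have : σ ≤ q / 2 / (κ / |g a| * A) := min_le_right _ _
    rw [le_div_iff₀ (by positivity)] at this
    linarith
  obtain ⟨ρ, hρ, hρest⟩ := hest σ hσ0
  refine ⟨κ, hκ0, q, hq0.le, hq1, ρ, hρ,
    fun ε ξ₁ ξ₂ τ₁ τ₂ x₁ x₂ hε hξ₁ hξ₂ hτ₁ hτ₂ hx₁0 hx₂0 hx₁ hx₂ => ?_⟩
  obtain ⟨h1, h2⟩ := hρest ε ξ₁ ξ₂ τ₁ τ₂ x₁ x₂ hε hξ₁ hξ₂ hτ₁ hτ₂ hx₁0 hx₂0 hx₁ hx₂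
  set m := max |ξ₁ - ξ₂| (κ * |τ₁ - τ₂|) with hm
  have hξm : |ξ₁ - ξ₂| ≤ m := le_max_left _ _
  have hm0 : 0 ≤ m := (abs_nonneg _).trans hξm
  have hτm : |τ₁ - τ₂| ≤ 1 / κ * m := by
    have : κ * |τ₁ - τ₂| ≤ m := le_max_right _ _
    rw [one_div, ← div_eq_inv_mul, le_div_iff₀ hκ0]
    linarith
  have hSm : σ * (|ξ₁ - ξ₂| + |τ₁ - τ₂|) ≤ σ * A * m := by
    rw [mul_assoc, hA, add_mul, one_mul]
    gcongr
  constructor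
  · have h3 := abs_add_le ((x₁ τ₁).1 - (x₂ τ₂).1 - μ * (ξ₁ - ξ₂)) (μ * (ξ₁ - ξ₂))
    rw [sub_add_cancel, abs_mul, abs_of_pos hμ0] at h3
    calc |(x₁ τ₁).1 - (x₂ τ₂).1| ≤ (1 - μ) / 2 * m + μ * m := by
          refine h3.trans (add_le_add (h1.trans (hSm.trans ?_)) ?_) <;> gcongr
      _ = q * m := by rw [hq]; ring
  · have he : κ * (τ₁ - τ₂) + κ / g a * ((x₁ τ₁).2 - (x₂ τ₂).2) =
        κ / g a * ((x₁ τ₁).2 - (x₂ τ₂).2 + g a * (τ₁ - τ₂)) := by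
      have := h.g_ne_zero
      field_simp
      ring
    rw [he, abs_mul, abs_div, abs_of_pos hκ0]
    calc κ / |g a| * |(x₁ τ₁).2 - (x₂ τ₂).2 + g a * (τ₁ - τ₂)|
        ≤ κ / |g a| * (D * m + σ * A * m) := by
          have : D * |ξ₁ - ξ₂| ≤ D * m := by gcongr
          gcongr
          linarith
      _ = (κ / |g a| * D + κ / |g a| * (σ * A)) * m := by ring
      _ ≤ (q / 2 + q / 2) * m := by gcongr
      _ = q * m := by ring

/-- For small `ε` the equation with parameter `τ` has, for exactly one `(ξ, τ)` near `(0, τ₀)`, a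
solution that starts at `(a + ξ, 0)` and returns there after the time `τ`; and `(ξ, τ)` is as close
to `(0, τ₀)` as desired if `ε` is small enough. -/
theorem exists_unique_return (h : IsPerturbedOrbit f g X K x₀ τ₀ a δ) :
    ∃ ρ > 0,
      (∀ (ε ξ₁ ξ₂ τ₁ τ₂ : ℝ) (x₁ x₂ : ℝ → ℝ × ℝ),
        |ε| ≤ ρ → |ξ₁| ≤ ρ → |ξ₂| ≤ ρ → |τ₁ - τ₀| ≤ ρ → |τ₂ - τ₀| ≤ ρ →
        x₁ 0 = (a + ξ₁, 0) → x₂ 0 = (a + ξ₂, 0) →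
        (∀ t, HasDerivAt x₁ (X ε τ₁ (x₁ t)) t) → (∀ t, HasDerivAt x₂ (X ε τ₂ (x₂ t)) t) →
        x₁ τ₁ = x₁ 0 → x₂ τ₂ = x₂ 0 → ξ₁ = ξ₂ ∧ τ₁ = τ₂) ∧
      ∀ ρ' > 0, ∃ ε₀ > 0, ∀ ε, |ε| ≤ ε₀ → ∃ (ξ τ : ℝ) (x : ℝ → ℝ × ℝ),
        |ξ| ≤ ρ' ∧ |τ - τ₀| ≤ ρ' ∧ x 0 = (a + ξ, 0) ∧ (∀ t, HasDerivAt x (X ε τ (x t)) t) ∧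
          x τ = x 0 := by
  obtain ⟨κ, hκ, q, hq0, hq1, ρ, hρ, hcon⟩ := h.exists_contraction
  have hga : 0 < |g a| := abs_pos.2 h.g_ne_zero
  have hτ := h.period_pos
  refine ⟨ρ, hρ, ?_, ?_⟩
  · intro ε ξ₁ ξ₂ τ₁ τ₂ x₁ x₂ hε hξ₁ hξ₂ hτ₁ hτ₂ hx₁0 hx₂0 hx₁ hx₂ hr₁ hr₂
    obtain ⟨h1, h2⟩ := hcon ε ξ₁ ξ₂ τ₁ τ₂ x₁ x₂ hε hξ₁ hξ₂ hτ₁ hτ₂ hx₁0 hx₂0 hx₁ hx₂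
    rw [hr₁, hr₂, hx₁0, hx₂0] at h1 h2
    simp only [add_sub_add_left_eq_sub, sub_self, mul_zero, add_zero, abs_mul,
      abs_of_pos hκ] at h1 h2
    set m := max |ξ₁ - ξ₂| (κ * |τ₁ - τ₂|)
    have hm : m ≤ q * m := max_le h1 h2
    have hm0 : m ≤ 0 := by nlinarith
    have hξ : |ξ₁ - ξ₂| ≤ 0 := (le_max_left _ _).trans hm0
    have hτ : κ * |τ₁ - τ₂| ≤ 0 := (le_max_right _ _).trans hm0
    have hτ' : |τ₁ - τ₂| ≤ 0 := by nlinarith [abs_nonneg (τ₁ - τ₂)]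
    exact ⟨sub_eq_zero.1 (abs_nonpos_iff.1 hξ), sub_eq_zero.1 (abs_nonpos_iff.1 hτ')⟩
  · intro ρ' hρ'
    obtain ⟨G, hG, hnear⟩ := h.exists_dist_orbit_le
    -- a box in the coordinates `(ξ, κ (τ - τ₀))` on which both `ξ` and `τ - τ₀` are small
    set R := min ρ ρ' * min 1 κ with hR
    have hR0 : 0 < R := by positivity
    have hR1 : R ≤ min ρ ρ' := mul_le_of_le_one_right (by positivity) (min_le_left _ _)
    have hRκ : R / κ ≤ min ρ ρ' := by
      rw [div_le_iff₀ hκ]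
      exact mul_le_mul_of_nonneg_left (min_le_right _ _) (by positivity)
    set A := G * (1 + κ / |g a|) with hA
    have hA0 : 0 < A := by positivity
    refine ⟨min (min 1 ρ) ((1 - q) * R / A), ?_, fun ε hε => ?_⟩
    · have : 0 < 1 - q := by linarith
      positivity
    have hε1 : |ε| ≤ 1 := hε.trans ((min_le_left _ _).trans (min_le_left _ _))
    have hερ : |ε| ≤ ρ := hε.trans ((min_le_left _ _).trans (min_le_right _ _))
    have hεR : A * |ε| ≤ (1 - q) * R := by
      have := hε.trans (min_le_right _ _)
      rw [le_div_iff₀ hA0] at this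
      linarith
    have hsol : ∀ ξ τ : ℝ, ∃ x : ℝ → ℝ × ℝ, x 0 = (a + ξ, 0) ∧
        ∀ t, HasDerivAt x (X ε τ (x t)) t := fun ξ τ => h.family.exists_solution hε1 τ _
    choose x hx0 hx using hsol
    set T : ℝ × ℝ → ℝ × ℝ := fun p => ((x p.1 (τ₀ + p.2 / κ) (τ₀ + p.2 / κ)).1 - a,
      p.2 + κ / g a * (x p.1 (τ₀ + p.2 / κ) (τ₀ + p.2 / κ)).2) with hT
    have hmem : ∀ p ∈ closedBall (0 : ℝ × ℝ) R, |p.1| ≤ min ρ ρ' ∧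
        |τ₀ + p.2 / κ - τ₀| ≤ min ρ ρ' := by
      intro p hp
      rw [mem_closedBall_zero_iff] at hp
      refine ⟨(norm_fst_le p).trans (hp.trans hR1), ?_⟩
      rw [add_sub_cancel_left, abs_div, abs_of_pos hκ]
      refine le_trans ?_ hRκ
      have : |p.2| ≤ R := (norm_snd_le p).trans hp
      gcongr
    have hTcon : ∀ p ∈ closedBall (0 : ℝ × ℝ) R, ∀ p' ∈ closedBall (0 : ℝ × ℝ) R,
        ‖T p - T p'‖ ≤ q * ‖p - p'‖ := by
      intro p hp p' hp'
      obtain ⟨hp1, hp2⟩ := hmem p hp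
      obtain ⟨hp1', hp2'⟩ := hmem p' hp'
      obtain ⟨h1, h2⟩ := hcon ε p.1 p'.1 _ _ _ _ hερ (hp1.trans (min_le_left _ _))
        (hp1'.trans (min_le_left _ _)) (hp2.trans (min_le_left _ _))
        (hp2'.trans (min_le_left _ _)) (hx0 p.1 (τ₀ + p.2 / κ)) (hx0 p'.1 (τ₀ + p'.2 / κ))
        (hx _ _) (hx _ _)
      have hs : κ * (τ₀ + p.2 / κ - (τ₀ + p'.2 / κ)) = p.2 - p'.2 := by
        field_simp
        ring
      have hmax : max |p.1 - p'.1| (κ * |τ₀ + p.2 / κ - (τ₀ + p'.2 / κ)|) = ‖p - p'‖ := by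
        rw [← abs_of_pos hκ, ← abs_mul, abs_of_pos hκ, hs]
        rfl
      rw [hmax] at h1 h2
      rw [hs] at h2
      refine max_le ?_ ?_
      · simpa [hT] using h1
      · refine le_trans (le_of_eq ?_) h2
        rw [Real.norm_eq_abs]
        congr 1
        simp only [hT, Prod.snd_sub]
        ring
    have hT0 : ‖T 0‖ ≤ (1 - q) * R := by
      refine le_trans ?_ hεR
      have h1 := hnear ε τ₀ 0 (x 0 τ₀) (hx 0 τ₀) τ₀ ⟨hτ.le, by linarith⟩
      have hxτ : x₀ τ₀ = (a, 0) := by rw [← h.initial]; simpa using h.periodic 0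
      rw [hx0, zero_add, h.initial, hxτ] at h1
      simp only [add_zero, sub_self, norm_zero, zero_add] at h1
      have h2 := (norm_fst_le _).trans h1
      have h3 := (norm_snd_le _).trans h1
      simp only [Prod.fst_sub, Prod.snd_sub, sub_zero, Real.norm_eq_abs] at h2 h3
      have h4 : 0 ≤ κ / |g a| * (G * |ε|) := by positivity
      have h5 : A * |ε| = G * |ε| + κ / |g a| * (G * |ε|) := by rw [hA]; ring
      rw [h5]
      refine max_le ?_ ?_
      · simpa [hT] using h2.trans (le_add_of_nonneg_right h4)
      · simp only [hT, Prod.fst_zero, Prod.snd_zero, zero_div, add_zero, zero_add,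
          Real.norm_eq_abs, abs_mul, abs_div, abs_of_pos hκ]
        have h6 : κ / |g a| * |(x 0 τ₀ τ₀).2| ≤ κ / |g a| * (G * |ε|) := by gcongr
        have h7 : 0 ≤ G * |ε| := by positivity
        linarith
    obtain ⟨p, hp, hfix⟩ := exists_fixedPoint_of_contraction hR0.le hq0 hq1 hTcon hT0
    obtain ⟨hp1, hp2⟩ := hmem p hp
    refine ⟨p.1, τ₀ + p.2 / κ, x p.1 (τ₀ + p.2 / κ), hp1.trans (min_le_right _ _),
      hp2.trans (min_le_right _ _), hx0 _ _, hx _ _, ?_⟩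
    have hf1 : (x p.1 (τ₀ + p.2 / κ) (τ₀ + p.2 / κ)).1 - a = p.1 := congrArg Prod.fst hfix
    have hf2 : p.2 + κ / g a * (x p.1 (τ₀ + p.2 / κ) (τ₀ + p.2 / κ)).2 = p.2 :=
      congrArg Prod.snd hfix
    rw [hx0]
    ext
    · simp only
      linarith
    · have : κ / g a ≠ 0 := div_ne_zero hκ.ne' h.g_ne_zero
      simpa [this] using hf2

/-- The derivative of `v` at the crossing of `Γ` with `v = 0` at `(a, 0)` is `-g a ≠ 0`, so every
solution that starts near `Γ` crosses `v = 0` near `(a, 0)` within two periods. -/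
theorem exists_crossing (h : IsPerturbedOrbit f g X K x₀ τ₀ a δ) {ρ : ℝ} (hρ : 0 < ρ) :
    ∃ δ' > 0, ∀ (ε τ s : ℝ) (x : ℝ → ℝ × ℝ), |ε| ≤ δ' → ‖x 0 - x₀ s‖ ≤ δ' →
      (∀ t, HasDerivAt x (X ε τ (x t)) t) → ∃ t, (x t).2 = 0 ∧ |(x t).1 - a| ≤ ρ := by
  obtain ⟨G, hG, hnear⟩ := h.exists_dist_orbit_le
  have hτ := h.period_pos
  have hga : 0 < |g a| := abs_pos.2 h.g_ne_zero
  have hv' : HasDerivAt (fun t => (x₀ t).2) (-g a) 0 := by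
    have := hasDerivAt_snd_comp (h.solution 0)
    rw [h.initial] at this
    simpa [lienardField] using this
  have hsmall : ∀ᶠ θ in 𝓝 (0 : ℝ), |(x₀ θ).2 + g a * θ| ≤ |g a| / 2 * |θ| ∧
      ‖x₀ θ - (a, 0)‖ ≤ ρ / 2 := by
    refine Filter.Eventually.and ?_ ?_
    · have := (hasDerivAt_iff_isLittleO.1 hv').def (c := |g a| / 2) (by positivity)
      filter_upwards [this] with θ hθ
      simpa [h.initial, mul_comm] using hθ
    · have := h.continuous.continuousAt (x := 0) |>.eventually
        (closedBall_mem_nhds _ (half_pos hρ))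
      filter_upwards [this] with θ hθ
      rwa [h.initial, dist_eq_norm] at hθ
  obtain ⟨β₁, hβ₁, hβ⟩ := Metric.eventually_nhds_iff.1 hsmall
  set β := min (β₁ / 2) (τ₀ / 2) with hβdef
  have hβ0 : 0 < β := by positivity
  have hββ₁ : β < β₁ := (min_le_left _ _).trans_lt (by linarith)
  have hβτ : β ≤ τ₀ / 2 := min_le_right _ _
  refine ⟨min (ρ / (4 * G)) (|g a| * β / (8 * G)), by positivity, fun ε τ s x hε hxs hx => ?_⟩
  set δ' := min (ρ / (4 * G)) (|g a| * β / (8 * G)) with hδ'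
  have hδ1 : 2 * G * δ' ≤ ρ / 2 := by
    have : δ' ≤ ρ / (4 * G) := min_le_left _ _
    rw [le_div_iff₀ (by positivity)] at this
    linarith
  have hδ2 : 2 * G * δ' ≤ |g a| * β / 4 := by
    have : δ' ≤ |g a| * β / (8 * G) := min_le_right _ _
    rw [le_div_iff₀ (by positivity)] at this
    linarith
  -- a time `t₁` at which the unperturbed solution is at `(a, 0)`
  obtain ⟨m, hm, -⟩ := existsUnique_add_zsmul_mem_Ico hτ (-s) (τ₀ / 2)
  set t₁ := -s + m • τ₀ with ht₁
  have hclose : ∀ θ ∈ Icc (-β) β, ‖x (t₁ + θ) - x₀ θ‖ ≤ 2 * G * δ' := by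
    intro θ hθ
    have h1 := hnear ε τ s x hx (t₁ + θ) ⟨by linarith [hm.1, hθ.1], by linarith [hm.2, hθ.2]⟩
    rw [show s + (t₁ + θ) = θ + m • τ₀ by rw [ht₁]; ring, h.periodic.zsmul m θ] at h1
    refine h1.trans ?_
    nlinarith
  have hsize : ∀ θ ∈ Icc (-β) β, |(x₀ θ).2 + g a * θ| ≤ |g a| / 2 * |θ| ∧
      ‖x₀ θ - (a, 0)‖ ≤ ρ / 2 := by
    intro θ hθ
    refine hβ ?_
    rw [Real.dist_eq, sub_zero]
    exact (abs_le.2 hθ).trans_lt hββ₁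
  have hend : ∀ θ ∈ Icc (-β) β, |θ| = β → |(x (t₁ + θ)).2 + g a * θ| < |g a| * β := by
    intro θ hθ hθβ
    have h1 := (norm_snd_le _).trans (hclose θ hθ)
    rw [Prod.snd_sub, Real.norm_eq_abs] at h1
    have h2 := (hsize θ hθ).1
    rw [hθβ] at h2
    have h3 := abs_add_le ((x (t₁ + θ)).2 - (x₀ θ).2) ((x₀ θ).2 + g a * θ)
    rw [← add_assoc, sub_add_cancel] at h3
    have : 0 < |g a| * β := by positivity
    linarith
  have hxc : Continuous fun θ => (x (t₁ + θ)).2 :=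
    continuous_snd.comp ((continuous_iff_continuousAt.2 fun t => (hx t).continuousAt).comp
      (continuous_const.add continuous_id))
  have hl : -β ∈ Icc (-β) β := ⟨le_rfl, by linarith⟩
  have hr : β ∈ Icc (-β) β := ⟨by linarith, le_rfl⟩
  have hel := abs_lt.1 (hend (-β) hl (by rw [abs_neg, abs_of_pos hβ0]))
  have her := abs_lt.1 (hend β hr (abs_of_pos hβ0))
  obtain ⟨θ, hθ, hθ0⟩ : ∃ θ ∈ Icc (-β) β, (x (t₁ + θ)).2 = 0 := by
    rcases lt_or_gt_of_ne h.g_ne_zero with hneg | hpos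
    · rw [abs_of_neg hneg] at hel her
      exact intermediate_value_Icc (by linarith) hxc.continuousOn ⟨by linarith, by linarith⟩
    · rw [abs_of_pos hpos] at hel her
      exact intermediate_value_Icc' (by linarith) hxc.continuousOn ⟨by linarith, by linarith⟩
  refine ⟨t₁ + θ, hθ0, ?_⟩
  have h1 := (norm_fst_le _).trans (hclose θ hθ)
  have h2 := (norm_fst_le _).trans (hsize θ hθ).2
  rw [Prod.fst_sub, Real.norm_eq_abs] at h1 h2
  have h3 := abs_add_le ((x (t₁ + θ)).1 - (x₀ θ).1) ((x₀ θ).1 - a)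
  rw [sub_add_sub_cancel] at h3
  simp only at h2
  linarith

end IsPerturbedOrbit

/-! ### Truncation of the perturbed Liénard equation -/

/-- The vector field of the equation `u'' + f(u) u' + g(u) = P(u, u')`. -/
def forcedLienardField (f g : ℝ → ℝ) (P : ℝ → ℝ → ℝ) (y : ℝ × ℝ) : ℝ × ℝ :=
  (y.2, -(f y.1 * y.2 + g y.1) + P y.1 y.2)

theorem IsLienardSolution.hasDerivAt {f g : ℝ → ℝ} {P : ℝ → ℝ → ℝ} {S : Set (ℝ × ℝ)} {u : ℝ → ℝ}
    (h : IsLienardSolution f g P S u) (t : ℝ) :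
    HasDerivAt (fun t => (u t, deriv u t)) (forcedLienardField f g P (u t, deriv u t)) t := by
  have h2 := (h.differentiable_deriv t).hasDerivAt
  rw [show deriv (deriv u) t = -(f (u t) * deriv u t + g (u t)) + P (u t) (deriv u t) by
    linarith [h.equation t]] at h2
  exact (h.differentiable t).hasDerivAt.prodMk h2

theorem isLienardSolution_of_hasDerivAt {f g : ℝ → ℝ} {P : ℝ → ℝ → ℝ} {S : Set (ℝ × ℝ)}
    {x : ℝ → ℝ × ℝ} (hx : ∀ t, HasDerivAt x (forcedLienardField f g P (x t)) t)
    (hS : ∀ t, x t ∈ S) :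
    IsLienardSolution f g P S (fun t => (x t).1) ∧ deriv (fun t => (x t).1) = fun t => (x t).2 := by
  have h1 : ∀ t, HasDerivAt (fun t => (x t).1) (x t).2 t := fun t => hasDerivAt_fst_comp (hx t)
  have h2 : ∀ t, HasDerivAt (fun t => (x t).2) _ t := fun t => hasDerivAt_snd_comp (hx t)
  have hd : deriv (fun t => (x t).1) = fun t => (x t).2 := funext fun t => (h1 t).deriv
  refine ⟨⟨fun t => (h1 t).differentiableAt, ?_, ?_, ?_⟩, hd⟩
  · rw [hd]
    exact fun t => (h2 t).differentiableAt
  · rw [hd]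
    exact hS
  · intro t
    rw [hd, (h2 t).deriv]
    simp only [forcedLienardField]
    ring

theorem Function.Periodic.deriv' {u : ℝ → ℝ} {T : ℝ} (h : Periodic u T) : Periodic (deriv u) T := by
  intro t
  rw [← deriv_comp_add_const, show (fun t => u (t + T)) = u from funext h]

/-- The closed disc `u² + v² ≤ c`. -/
def closedPhaseDisc (c : ℝ) : Set (ℝ × ℝ) := {x | x.1 ^ 2 + x.2 ^ 2 ≤ c}

theorem convex_closedPhaseDisc (c : ℝ) : Convex ℝ (closedPhaseDisc c) := by
  intro x hx y hy s t hs ht hst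
  simp only [closedPhaseDisc, mem_ofPred_eq, Prod.fst_add, Prod.snd_add, Prod.smul_fst,
    Prod.smul_snd, smul_eq_mul] at hx hy ⊢
  have key : ∀ p q : ℝ, (s * p + t * q) ^ 2 ≤ s * p ^ 2 + t * q ^ 2 := fun p q => by
    obtain rfl : t = 1 - s := by linarith
    nlinarith [mul_nonneg (mul_nonneg hs ht) (sq_nonneg (p - q))]
  have h1 : s * (x.1 ^ 2 + x.2 ^ 2) ≤ s * c := mul_le_mul_of_nonneg_left hx hs
  have h2 : t * (y.1 ^ 2 + y.2 ^ 2) ≤ t * c := mul_le_mul_of_nonneg_left hy ht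
  have h3 : s * c + t * c = c := by rw [← add_mul, hst, one_mul]
  linarith [key x.1 y.1, key x.2 y.2]

theorem isCompact_closedPhaseDisc (c : ℝ) : IsCompact (closedPhaseDisc c) := by
  refine (isCompact_closedBall (0 : ℝ × ℝ) (c + 1)).of_isClosed_subset
    (isClosed_le (by fun_prop) continuous_const) fun x hx => ?_
  simp only [closedPhaseDisc, mem_ofPred_eq] at hx
  rw [mem_closedBall_zero_iff]
  refine max_le ?_ ?_ <;> rw [Real.norm_eq_abs] <;> apply abs_le_of_sq_le_sq <;>
    nlinarith [sq_nonneg x.1, sq_nonneg x.2]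

theorem closedPhaseDisc_subset {c r : ℝ} (h : c < r ^ 2) : closedPhaseDisc c ⊆ phaseDisc r :=
  fun _ hx => lt_of_le_of_lt hx h

/-- A compact subset of the open disc lies in the interior of a smaller closed disc. -/
theorem IsCompact.exists_lt_of_subset_phaseDisc {Γ : Set (ℝ × ℝ)} (hΓ : IsCompact Γ) {r : ℝ}
    (h : Γ ⊆ phaseDisc r) : ∃ c < r ^ 2, ∀ x ∈ Γ, x.1 ^ 2 + x.2 ^ 2 < c := by
  rcases Γ.eq_empty_or_nonempty with rfl | hne
  · exact ⟨r ^ 2 - 1, by linarith, by simp⟩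
  · obtain ⟨y, hy, hmax⟩ := hΓ.exists_isMaxOn hne
      (f := fun x : ℝ × ℝ => x.1 ^ 2 + x.2 ^ 2) (by fun_prop)
    have hyr : y.1 ^ 2 + y.2 ^ 2 < r ^ 2 := h hy
    obtain ⟨c, hc1, hc2⟩ := exists_between hyr
    exact ⟨c, hc2, fun x hx => (hmax hx).trans_lt hc1⟩

/-- Solutions of an equation with `C¹` right-hand side in the open disc are determined by their
initial values. -/
theorem solution_unique_of_mem_phaseDisc {Y : ℝ × ℝ → ℝ × ℝ} {r L : ℝ}
    (hY : ContDiffOn ℝ 1 Y (phaseDisc r)) {x y : ℝ → ℝ × ℝ}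
    (hx : ∀ t ∈ Icc 0 L, HasDerivAt x (Y (x t)) t) (hy : ∀ t ∈ Icc 0 L, HasDerivAt y (Y (y t)) t)
    (hxr : ∀ t ∈ Icc 0 L, x t ∈ phaseDisc r) (hyr : ∀ t ∈ Icc 0 L, y t ∈ phaseDisc r)
    (h0 : x 0 = y 0) : EqOn x y (Icc 0 L) := by
  have hxc : ContinuousOn x (Icc 0 L) := fun t ht => (hx t ht).continuousAt.continuousWithinAt
  have hyc : ContinuousOn y (Icc 0 L) := fun t ht => (hy t ht).continuousAt.continuousWithinAt
  obtain ⟨c, hc, hcmem⟩ := ((isCompact_Icc.image_of_continuousOn hxc).union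
    (isCompact_Icc.image_of_continuousOn hyc)).exists_lt_of_subset_phaseDisc (r := r) (by
      rintro _ (⟨t, ht, rfl⟩ | ⟨t, ht, rfl⟩)
      · exact hxr t ht
      · exact hyr t ht)
  obtain ⟨M, hM⟩ := (hY.mono (closedPhaseDisc_subset hc)).exists_lipschitzOnWith one_ne_zero
    (convex_closedPhaseDisc c) (isCompact_closedPhaseDisc c)
  exact ODE_solution_unique_of_mem_Icc_right (v := fun _ => Y) (s := fun _ => closedPhaseDisc c)
    (fun _ _ => hM) hxc (fun t ht => (hx t (Ico_subset_Icc_self ht)).hasDerivWithinAt)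
    (fun t ht => (hcmem _ (Or.inl (mem_image_of_mem _ (Ico_subset_Icc_self ht)))).le) hyc
    (fun t ht => (hy t (Ico_subset_Icc_self ht)).hasDerivWithinAt)
    (fun t ht => (hcmem _ (Or.inr (mem_image_of_mem _ (Ico_subset_Icc_self ht)))).le) h0

/-- Fields of the form `(V, -q + ε p)` with bounded Lipschitz `V`, `q`, `p` are perturbation
families. -/
theorem exists_isPerturbationFamily {V q : ℝ × ℝ → ℝ} {p : (ℝ × ℝ) × ℝ × ℝ → ℝ} {LV Lq Lp : ℝ≥0}
    {MV Mq Mp : ℝ} (hV : LipschitzWith LV V) (hq : LipschitzWith Lq q) (hp : LipschitzWith Lp p)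
    (hMV : ∀ x, |V x| ≤ MV) (hMq : ∀ x, |q x| ≤ Mq) (hMp : ∀ x, |p x| ≤ Mp) :
    ∃ K, IsPerturbationFamily (fun ε τ y => (V y, -q y + ε * p (y, ε, τ))) K := by
  have hMp0 : 0 ≤ Mp := (abs_nonneg _).trans (hMp 0)
  have hLV := LV.coe_nonneg
  have hLq := Lq.coe_nonneg
  have hLp := Lp.coe_nonneg
  set K : ℝ := 1 + LV + Lq + Lp + Mp with hK
  have hV' : ∀ x y, |V x - V y| ≤ LV * ‖x - y‖ := fun x y => by
    simpa [Real.dist_eq, dist_eq_norm] using hV.dist_le_mul x y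
  have hq' : ∀ x y, |q x - q y| ≤ Lq * ‖x - y‖ := fun x y => by
    simpa [Real.dist_eq, dist_eq_norm] using hq.dist_le_mul x y
  refine ⟨K, by rw [hK]; linarith, ?_, ?_, ?_, ?_⟩
  · intro τ τ' x y
    refine max_le ?_ ?_
    · refine (hV' x y).trans ?_
      gcongr
      linarith
    · have : ‖-q x + 0 * p (x, 0, τ) - (-q y + 0 * p (y, 0, τ'))‖ = |q x - q y| := by
        rw [Real.norm_eq_abs, ← abs_neg]
        congr 1
        ring
      refine this.le.trans ((hq' x y).trans ?_)
      gcongr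
      linarith
  · intro ε τ x
    refine max_le ?_ ?_
    · simp only [Prod.fst_sub, sub_self, norm_zero]
      positivity
    · have : ‖-q x + ε * p (x, ε, τ) - (-q x + 0 * p (x, 0, τ))‖ = |p (x, ε, τ)| * |ε| := by
        rw [Real.norm_eq_abs, ← abs_mul]
        congr 1
        ring
      refine this.le.trans ?_
      gcongr
      refine (hMp _).trans ?_
      linarith
  · intro ε τ τ' x y
    refine max_le ?_ ?_
    · simp only [Prod.fst_sub, sub_self, norm_zero]
      positivity
    · have h1 : ‖-q x + ε * p (x, ε, τ) - (-q y + ε * p (y, ε, τ')) -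
          (-q x + 0 * p (x, 0, τ) - (-q y + 0 * p (y, 0, τ')))‖ =
          |ε| * |p (x, ε, τ) - p (y, ε, τ')| := by
        rw [Real.norm_eq_abs, ← abs_mul]
        congr 1
        ring
      have h2 : |p (x, ε, τ) - p (y, ε, τ')| ≤ Lp * (‖x - y‖ + |τ - τ'|) := by
        have h3 := hp.dist_le_mul (x, ε, τ) (y, ε, τ')
        rw [Real.dist_eq] at h3
        refine h3.trans ?_
        gcongr
        rw [dist_eq_norm]
        refine max_le (le_add_of_nonneg_right (abs_nonneg _)) (max_le ?_ ?_)
        · simp only [Prod.snd_sub, Prod.fst_sub, sub_self, norm_zero]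
          positivity
        · exact le_add_of_nonneg_left (norm_nonneg _)
      refine h1.le.trans ?_
      rw [mul_comm K, mul_assoc]
      refine mul_le_mul_of_nonneg_left (h2.trans ?_) (abs_nonneg ε)
      gcongr
      linarith
  · intro ε τ
    have hMV0 : 0 ≤ MV := (abs_nonneg _).trans (hMV 0)
    have hMq0 : 0 ≤ Mq := (abs_nonneg _).trans (hMq 0)
    refine ⟨MV + (Mq + |ε| * Mp), fun x => max_le ?_ ?_⟩
    · exact (hMV x).trans (le_add_of_nonneg_right (by positivity))
    · refine (abs_add_le _ _).trans ?_
      rw [abs_neg, abs_mul]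
      have : |ε| * |p (x, ε, τ)| ≤ |ε| * Mp := by
        have := hMp (x, ε, τ)
        gcongr
      linarith [hMq x]

/-- The perturbed Liénard equation agrees near the closed orbit with a family of bounded, globally
Lipschitz fields: restrict everything to a closed disc whose interior contains the orbit, and
extend. -/
theorem exists_truncation {f g : ℝ → ℝ} (hf : ContDiff ℝ 2 f) (hg : ContDiff ℝ 2 g)
    {u₀ : ℝ → ℝ} {τ₀ a r : ℝ} (hu₀ : IsLienardSolution f g (fun _ _ => 0) (phaseDisc r) u₀)
    (hper : IsNonconstantPeriodic u₀ τ₀) (ha : u₀ 0 = a) (ha' : deriv u₀ 0 = 0)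
    (hint : 0 < ∫ t in (0 : ℝ)..τ₀, f (u₀ t)) {γ : ℝ → ℝ → ℝ → ℝ → ℝ} {e T : ℝ}
    (he : 0 < e) (hT : 0 < T)
    (hγ : ContDiffOn ℝ 2 (fun x : ℝ × ℝ × ℝ × ℝ => γ x.1 x.2.1 x.2.2.1 x.2.2.2)
      {x | (x.1, x.2.1) ∈ phaseDisc r ∧ |x.2.2.1| < e ∧ |x.2.2.2 - τ₀| < T}) :
    ∃ (X : ℝ → ℝ → ℝ × ℝ → ℝ × ℝ) (K δ : ℝ),
      IsPerturbedOrbit f g X K (fun t => (u₀ t, deriv u₀ t)) τ₀ a δ ∧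
      (∀ t y, ‖y - (u₀ t, deriv u₀ t)‖ < δ → y ∈ phaseDisc r) ∧
      ∀ ε τ t y, |ε| ≤ e / 2 → |τ - τ₀| ≤ T / 2 → ‖y - (u₀ t, deriv u₀ t)‖ < δ →
        X ε τ y = forcedLienardField f g (fun u v => ε * γ u v ε τ) y := by
  obtain ⟨hτ, hu₀per, hnc⟩ := hper
  have hf1 : ContDiff ℝ 1 f := hf.of_le (by norm_num)
  have hg1 : ContDiff ℝ 1 g := hg.of_le (by norm_num)
  set x₀ : ℝ → ℝ × ℝ := fun t => (u₀ t, deriv u₀ t) with hx₀def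
  have hx₀per : Periodic x₀ τ₀ := fun t => Prod.ext (hu₀per t) (hu₀per.deriv' t)
  have hx₀ : ∀ t, HasDerivAt x₀ (lienardField f g (x₀ t)) t := fun t => by
    have := hu₀.hasDerivAt t
    simpa [forcedLienardField, lienardField] using this
  have hx₀c : Continuous x₀ := continuous_iff_continuousAt.2 fun t => (hx₀ t).continuousAt
  set Γ := x₀ '' Icc 0 τ₀ with hΓ
  have hΓc : IsCompact Γ := isCompact_Icc.image hx₀c
  have hmemΓ : ∀ t, x₀ t ∈ Γ := by
    intro t
    obtain ⟨s, hs, hst⟩ := hx₀per.exists_mem_Ico₀ hτ t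
    exact ⟨s, Ico_subset_Icc_self hs, hst.symm⟩
  obtain ⟨c, hc, hcΓ⟩ := hΓc.exists_lt_of_subset_phaseDisc (r := r) (by
    rintro _ ⟨t, -, rfl⟩
    exact hu₀.mem t)
  obtain ⟨δ, hδ, hδc⟩ := hΓc.exists_thickening_subset_open
    (t := {x : ℝ × ℝ | x.1 ^ 2 + x.2 ^ 2 < c}) (isOpen_lt (by fun_prop) continuous_const) hcΓ
  have htube : ∀ t y, ‖y - x₀ t‖ < δ → y ∈ closedPhaseDisc c := by
    intro t y hy
    have : y ∈ thickening δ Γ := mem_thickening_iff.2 ⟨x₀ t, hmemΓ t, by rwa [dist_eq_norm]⟩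
    have hlt : y.1 ^ 2 + y.2 ^ 2 < c := hδc this
    exact hlt.le
  -- the three functions that are truncated
  obtain ⟨Lv, hLv⟩ := (contDiff_snd (𝕜 := ℝ) (E := ℝ) (F := ℝ) (n := 1)).contDiffOn
    |>.exists_lipschitzOnWith one_ne_zero (convex_closedPhaseDisc c) (isCompact_closedPhaseDisc c)
  have hQ : ContDiff ℝ 1 fun y : ℝ × ℝ => f y.1 * y.2 + g y.1 :=
    ((hf1.comp contDiff_fst).mul contDiff_snd).add (hg1.comp contDiff_fst)
  obtain ⟨Lq, hLq⟩ := hQ.contDiffOn.exists_lipschitzOnWith one_ne_zero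
    (convex_closedPhaseDisc c) (isCompact_closedPhaseDisc c)
  set B : Set ((ℝ × ℝ) × ℝ × ℝ) :=
    closedPhaseDisc c ×ˢ (closedBall 0 (e / 2) ×ˢ closedBall τ₀ (T / 2)) with hB
  have hBc : IsCompact B := (isCompact_closedPhaseDisc c).prod
    ((isCompact_closedBall _ _).prod (isCompact_closedBall _ _))
  have hBconv : Convex ℝ B := (convex_closedPhaseDisc c).prod
    ((convex_closedBall _ _).prod (convex_closedBall _ _))
  have hγB : ContDiffOn ℝ 2
      (fun z : (ℝ × ℝ) × ℝ × ℝ => γ z.1.1 z.1.2 z.2.1 z.2.2) B := by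
    have hι : ContDiff ℝ 2 fun z : (ℝ × ℝ) × ℝ × ℝ => (z.1.1, z.1.2, z.2.1, z.2.2) := by fun_prop
    refine hγ.comp hι.contDiffOn ?_
    rintro ⟨y, ε, τ⟩ ⟨hy, hε, hτ'⟩
    rw [mem_closedBall, dist_zero_right, Real.norm_eq_abs] at hε
    rw [mem_closedBall, Real.dist_eq] at hτ'
    simp only at hε hτ'
    exact ⟨closedPhaseDisc_subset hc hy, by simp only; linarith, by simp only; linarith⟩
  obtain ⟨Lp, hLp⟩ := hγB.exists_lipschitzOnWith two_ne_zero hBconv hBc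
  obtain ⟨V, hV, ⟨MV, hMV⟩, hVeq⟩ := hLv.exists_bounded_extension (isCompact_closedPhaseDisc c)
  obtain ⟨q, hq, ⟨Mq, hMq⟩, hqeq⟩ := hLq.exists_bounded_extension (isCompact_closedPhaseDisc c)
  obtain ⟨p, hp, ⟨Mp, hMp⟩, hpeq⟩ := hLp.exists_bounded_extension hBc
  obtain ⟨K, hX⟩ := exists_isPerturbationFamily hV hq hp hMV hMq hMp
  set X : ℝ → ℝ → ℝ × ℝ → ℝ × ℝ := fun ε τ y => (V y, -q y + ε * p (y, ε, τ)) with hXdef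
  have hXeq : ∀ ε τ t y, |ε| ≤ e / 2 → |τ - τ₀| ≤ T / 2 → ‖y - x₀ t‖ < δ →
      X ε τ y = forcedLienardField f g (fun u v => ε * γ u v ε τ) y := by
    intro ε τ t y hε hτ' hy
    have hyc := htube t y hy
    have h1 : y.2 = V y := hVeq hyc
    have h2 : f y.1 * y.2 + g y.1 = q y := hqeq hyc
    have h3 : γ y.1 y.2 ε τ = p (y, ε, τ) := hpeq (x := (y, ε, τ))
      ⟨hyc, by simpa [Real.dist_eq] using hε, by simpa [Real.dist_eq] using hτ'⟩
    simp only [hXdef, forcedLienardField, ← h1, ← h2, ← h3]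
  have hX0 : ∀ τ t y, ‖y - x₀ t‖ < δ → X 0 τ y = lienardField f g y := by
    intro τ t y hy
    have hyc := htube t y hy
    have h1 : y.2 = V y := hVeq hyc
    have h2 : f y.1 * y.2 + g y.1 = q y := hqeq hyc
    simp only [hXdef, lienardField, ← h1, ← h2, zero_mul, add_zero]
  have hx₀0 : x₀ 0 = (a, 0) := Prod.ext ha ha'
  have hga : g a ≠ 0 := by
    -- otherwise `(a, 0)` is an equilibrium, and `u₀` is constant
    intro hga
    have hconst : ∀ t, HasDerivAt (fun _ : ℝ => ((a, 0) : ℝ × ℝ)) (X 0 τ₀ (a, 0)) t := by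
      intro t
      rw [hX0 τ₀ 0 (a, 0) (by rw [hx₀0]; simpa using hδ)]
      exact (hasDerivAt_const t ((a, 0) : ℝ × ℝ)).congr_deriv (by ext <;> simp [lienardField, hga])
    obtain ⟨L, hL⟩ := hX.lipschitzWith (ε := 0) (by simp) τ₀
    have := hL.solution_unique (t₀ := 0)
      (fun t => by rw [hX0 τ₀ t (x₀ t) (by simpa using hδ)]; exact hx₀ t) hconst hx₀0
    exact hnc ⟨a, fun t => congrArg Prod.fst (congrFun this t)⟩
  exact ⟨X, K, δ,
    { family := hX
      contDiff_f := hf1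
      contDiff_g := hg1
      period_pos := hτ
      radius_pos := hδ
      solution := hx₀
      periodic := hx₀per
      initial := hx₀0
      g_ne_zero := hga
      eq_lienardField := hX0
      integral_pos := hint },
    fun t y hy => closedPhaseDisc_subset hc (htube t y hy), hXeq⟩

/-! ### Existence and uniqueness of the perturbed periodic solution -/

theorem contDiffOn_forcedLienardField {f g : ℝ → ℝ} (hf : ContDiff ℝ 1 f) (hg : ContDiff ℝ 1 g)
    {γ : ℝ → ℝ → ℝ → ℝ → ℝ} {e T r τ₀ : ℝ}
    (hγ : ContDiffOn ℝ 1 (fun x : ℝ × ℝ × ℝ × ℝ => γ x.1 x.2.1 x.2.2.1 x.2.2.2)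
      {x | (x.1, x.2.1) ∈ phaseDisc r ∧ |x.2.2.1| < e ∧ |x.2.2.2 - τ₀| < T})
    {ε τ : ℝ} (hε : |ε| < e) (hτ : |τ - τ₀| < T) :
    ContDiffOn ℝ 1 (forcedLienardField f g (fun u v => ε * γ u v ε τ)) (phaseDisc r) := by
  have hQ : ContDiff ℝ 1 fun y : ℝ × ℝ => -(f y.1 * y.2 + g y.1) :=
    (((hf.comp contDiff_fst).mul contDiff_snd).add (hg.comp contDiff_fst)).neg
  have hι : ContDiff ℝ 1 fun y : ℝ × ℝ => (y.1, y.2, ε, τ) := by fun_prop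
  have hP : ContDiffOn ℝ 1 (fun y : ℝ × ℝ => ε * γ y.1 y.2 ε τ) (phaseDisc r) :=
    contDiffOn_const.mul (hγ.comp hι.contDiffOn fun y hy => ⟨hy, hε, hτ⟩)
  exact contDiff_snd.contDiffOn.prodMk (hQ.contDiffOn.add hP)

/-- If a curve with period at most `L` satisfies a condition during the time `L`, it always
does. -/
theorem Function.Periodic.forall_of_forall_Icc {α : Type*} {x : ℝ → α} {T L : ℝ} {p : α → Prop}
    (h : Periodic x T) (hT : 0 < T) (hTL : T ≤ L) (hp : ∀ t ∈ Icc 0 L, p (x t)) (t : ℝ) :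
    p (x t) := by
  obtain ⟨s, hs, hst⟩ := h.exists_mem_Ico₀ hT t
  rw [hst]
  exact hp s ⟨hs.1, hs.2.le.trans hTL⟩

theorem mainTheorem2
    (f g : ℝ → ℝ) (hf : ContDiff ℝ 2 f) (hg : ContDiff ℝ 2 g)
    -- the periodic solution of the unperturbed equation
    (u₀ : ℝ → ℝ) (τ₀ a r : ℝ)
    (hu₀ : IsLienardSolution f g (fun _ _ => 0) (phaseDisc r) u₀)
    (hper : IsNonconstantPeriodic u₀ τ₀)
    (ha : u₀ 0 = a) (ha' : deriv u₀ 0 = 0)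
    (hint : 0 < ∫ t in (0 : ℝ)..τ₀, f (u₀ t))
    -- the perturbation `γ(u, u', ε, τ)`
    (γ : ℝ → ℝ → ℝ → ℝ → ℝ) (e T : ℝ) (he : 0 < e) (hT : 0 < T)
    (hγ : ContDiffOn ℝ 2 (fun x : ℝ × ℝ × ℝ × ℝ => γ x.1 x.2.1 x.2.2.1 x.2.2.2)
      {x | (x.1, x.2.1) ∈ phaseDisc r ∧ |x.2.2.1| < e ∧ |x.2.2.2 - τ₀| < T}) :
    ∃ ε₀ τ₁ : ℝ, 0 < ε₀ ∧ ε₀ < e ∧ 0 < τ₁ ∧ τ₁ < τ₀ / 2 ∧ τ₁ ≤ T ∧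
    ∃ N : Set (ℝ × ℝ), IsOpen N ∧ N ⊆ phaseDisc r ∧ (∀ t, (u₀ t, deriv u₀ t) ∈ N) ∧
    ∃ τ h : ℝ → ℝ, τ 0 = τ₀ ∧ h 0 = 0 ∧
      ∀ ε : ℝ, |ε| ≤ ε₀ →
        |τ ε - τ₀| < τ₁ ∧
        ∃ u : ℝ → ℝ,
          IsLienardSolution f g (fun x y => ε * γ x y ε (τ ε)) (phaseDisc r) u ∧
          IsNonconstantPeriodic u (τ ε) ∧
          u 0 = a + h ε ∧ deriv u 0 = 0 ∧
          (∀ t, (u t, deriv u t) ∈ N) ∧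
          -- uniqueness, up to a shift of time, of the periodic solution and of its period
          ∀ (τ' : ℝ) (w : ℝ → ℝ), |τ' - τ₀| < τ₁ →
            IsLienardSolution f g (fun x y => ε * γ x y ε τ') (phaseDisc r) w →
            IsNonconstantPeriodic w τ' →
            (∃ t, (w t, deriv w t) ∈ N) →
            τ' = τ ε ∧ ∃ s, ∀ t, w t = u (t + s) := by
  obtain ⟨X, K, δ, hO, hdisc, hX⟩ := exists_truncation hf hg hu₀ hper ha ha' hint he hT hγ
  set x₀ : ℝ → ℝ × ℝ := fun t => (u₀ t, deriv u₀ t) with hx₀def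
  have hτ₀ := hO.period_pos
  have hδ := hO.radius_pos
  have hK := hO.family.one_le
  have hga : 0 < |g a| := abs_pos.2 hO.g_ne_zero
  obtain ⟨G, hG, hnear⟩ := hO.exists_dist_orbit_le
  obtain ⟨ρ, hρ, huniq, hexist⟩ := hO.exists_unique_return
  obtain ⟨δ₁, hδ₁, hcross⟩ := hO.exists_crossing hρ
  -- `N` is the `δ₂`-neighbourhood of the orbit: solutions that meet it stay in the `δ`-tube for two
  -- periods and cross the transversal
  set δ₂ := min δ₁ (δ / (4 * G)) with hδ₂
  have hδ₂0 : 0 < δ₂ := by positivity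
  have hδ₂δ : 4 * G * δ₂ ≤ δ := by
    have : δ₂ ≤ δ / (4 * G) := min_le_right _ _
    rw [le_div_iff₀ (by positivity)] at this
    linarith
  have hδ₂δ' : δ₂ ≤ δ := by nlinarith
  set τ₁ := min ρ (min (τ₀ / 4) (T / 2)) with hτ₁
  have hτ₁0 : 0 < τ₁ := by positivity
  have hτ₁ρ : τ₁ ≤ ρ := min_le_left _ _
  have hτ₁τ : τ₁ ≤ τ₀ / 4 := (min_le_right _ _).trans (min_le_left _ _)
  have hτ₁T : τ₁ ≤ T / 2 := (min_le_right _ _).trans (min_le_right _ _)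
  -- `ρ'` bounds the displacement of the initial value and of the period
  set ρ' := min (min ρ (τ₁ / 2)) (min (δ₂ / (4 * G)) (|g a| / (4 * K))) with hρ'
  have hρ'0 : 0 < ρ' := by positivity
  have hρ'ρ : ρ' ≤ ρ := (min_le_left _ _).trans (min_le_left _ _)
  have hρ'τ : ρ' < τ₁ := ((min_le_left _ _).trans (min_le_right _ _)).trans_lt (by linarith)
  have hρ'δ : 4 * G * ρ' ≤ δ₂ := by
    have : ρ' ≤ δ₂ / (4 * G) := (min_le_right _ _).trans (min_le_left _ _)
    rw [le_div_iff₀ (by positivity)] at this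
    linarith
  have hρ'g : 4 * K * ρ' ≤ |g a| := by
    have : ρ' ≤ |g a| / (4 * K) := (min_le_right _ _).trans (min_le_right _ _)
    rw [le_div_iff₀ (by positivity)] at this
    linarith
  obtain ⟨ε₁, hε₁, hε₁ex⟩ := hexist ρ' hρ'0
  set ε₀ := min (min ε₁ (e / 2)) (min 1 (min ρ' δ₂)) with hε₀
  have hε₀0 : 0 < ε₀ := by positivity
  have hε₀e : ε₀ ≤ e / 2 := (min_le_left _ _).trans (min_le_right _ _)
  have hε₀1 : ε₀ ≤ 1 := (min_le_right _ _).trans (min_le_left _ _)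
  have hε₀ρ : ε₀ ≤ ρ' := (min_le_right _ _).trans ((min_le_right _ _).trans (min_le_left _ _))
  have hε₀δ : ε₀ ≤ δ₂ := (min_le_right _ _).trans ((min_le_right _ _).trans (min_le_right _ _))
  have hex : ∀ ε, |ε| ≤ ε₀ → ∃ (ξ τ : ℝ) (x : ℝ → ℝ × ℝ), |ξ| ≤ ρ' ∧ |τ - τ₀| ≤ ρ' ∧
      x 0 = (a + ξ, 0) ∧ (∀ t, HasDerivAt x (X ε τ (x t)) t) ∧ x τ = x 0 := fun ε hε =>
    hε₁ex ε (hε.trans ((min_le_left _ _).trans (min_le_left _ _)))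
  choose! h τ x hh hτ hx0 hx hxτ using hex
  refine ⟨ε₀, τ₁, hε₀0, by linarith, hτ₁0, by linarith, by linarith, ⋃ t, ball (x₀ t) δ₂,
    isOpen_iUnion fun _ => isOpen_ball, ?_, fun t => mem_iUnion.2 ⟨t, mem_ball_self hδ₂0⟩,
    τ, h, ?_⟩
  · intro y hy
    obtain ⟨t, ht⟩ := mem_iUnion.1 hy
    rw [mem_ball, dist_eq_norm] at ht
    exact hdisc t y (ht.trans_le hδ₂δ')
  have h00 : |(0 : ℝ)| ≤ ε₀ := by simpa using hε₀0.le
  -- at `ε = 0` the unperturbed solution is the unique one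
  have hzero := huniq 0 (h 0) 0 (τ 0) τ₀ (x 0) x₀ (by simpa using hρ.le) ((hh 0 h00).trans hρ'ρ)
    (by simpa using hρ.le) ((hτ 0 h00).trans hρ'ρ) (by simpa using hρ.le) (hx0 0 h00)
    (by rw [hO.initial, add_zero]) (hx 0 h00) (hO.solution' τ₀) (hxτ 0 h00)
    (by simpa using hO.periodic 0)
  refine ⟨hzero.2, hzero.1, fun ε hε => ?_⟩
  have hε1 : |ε| ≤ 1 := hε.trans hε₀1
  have hεe : |ε| ≤ e / 2 := hε.trans hε₀e
  have hτε : |τ ε - τ₀| < τ₁ := (hτ ε hε).trans_lt hρ'τ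
  have hperiod : ∀ τ', |τ' - τ₀| < τ₁ → 0 < τ' ∧ τ' ≤ 2 * τ₀ ∧ |τ' - τ₀| ≤ T / 2 := by
    intro τ' hτ'
    have := abs_lt.1 hτ'
    exact ⟨by linarith, by linarith, by linarith⟩
  obtain ⟨hτ0, hτ2, hτT⟩ := hperiod _ hτε
  obtain ⟨L, hL⟩ := hO.family.lipschitzWith hε1 (τ ε)
  have hxper : Periodic (x ε) (τ ε) := hL.periodic_of_return (hx ε hε) (hxτ ε hε)
  have hxN : ∀ t, ∃ s, ‖x ε t - x₀ s‖ < δ₂ :=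
    hxper.forall_of_forall_Icc hτ0 hτ2 (p := fun y => ∃ s, ‖y - x₀ s‖ < δ₂) fun t ht => by
      refine ⟨0 + t, (hnear ε (τ ε) 0 (x ε) (hx ε hε) t ht).trans_lt ?_⟩
      rw [hx0 ε hε, hO.initial,
        show ‖((a + h ε, 0) : ℝ × ℝ) - (a, 0)‖ = |h ε| by simp [Prod.norm_def]]
      have h1 := hh ε hε
      have h2 : G * (|h ε| + |ε|) ≤ G * (ρ' + ρ') := by
        have := hε.trans hε₀ρ
        gcongr
      nlinarith
  have hxtrue : ∀ t,
      HasDerivAt (x ε) (forcedLienardField f g (fun u v => ε * γ u v ε (τ ε)) (x ε t)) t := by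
    intro t
    obtain ⟨s, hs⟩ := hxN t
    rw [← hX ε (τ ε) s (x ε t) hεe hτT (hs.trans_le hδ₂δ')]
    exact hx ε hε t
  have hxS : ∀ t, x ε t ∈ phaseDisc r := fun t => by
    obtain ⟨s, hs⟩ := hxN t
    exact hdisc s _ (hs.trans_le hδ₂δ')
  obtain ⟨husol, hud⟩ := isLienardSolution_of_hasDerivAt hxtrue hxS
  refine ⟨hτε, fun t => (x ε t).1, husol, ⟨hτ0, fun t => congrArg Prod.fst (hxper t), ?_⟩, ?_, ?_,
    ?_, ?_⟩
  · -- a constant solution would be an equilibrium near `(a, 0)`, where the field is about `(0, -g a)`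
    rintro ⟨c, hc⟩
    have hv : ∀ t, (x ε t).2 = 0 := fun t => by
      rw [← congrFun hud t, show (fun t => (x ε t).1) = fun _ => c from funext hc]
      simp
    have hconst : x ε = fun _ => (c, 0) := funext fun t => Prod.ext (hc t) (hv t)
    have hX0 : X ε (τ ε) (x ε 0) = 0 := by
      have h1 := hx ε hε 0
      have h2 : HasDerivAt (x ε) 0 0 := by
        rw [hconst]
        exact hasDerivAt_const _ _
      exact h1.unique h2
    have h3 := hO.family.norm_sub_le_base ε (τ ε) (τ ε) (x ε 0) (x₀ 0)
    rw [hX0, hO.eq_lienardField (τ ε) 0 (x₀ 0) (by simpa using hδ), hx0 ε hε, hO.initial,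
      show ‖((a + h ε, 0) : ℝ × ℝ) - (a, 0)‖ = |h ε| by simp [Prod.norm_def], zero_sub,
      norm_neg] at h3
    have h4 := (norm_snd_le _).trans h3
    simp only [lienardField, mul_zero, zero_add, norm_neg, Real.norm_eq_abs] at h4
    have h5 : K * |h ε| ≤ K * ρ' := by
      have := hh ε hε
      gcongr
    have h6 : K * |ε| ≤ K * ρ' := by
      have := hε.trans hε₀ρ
      gcongr
    linarith
  · exact congrArg Prod.fst (hx0 ε hε)
  · rw [hud]
    simp only [hx0 ε hε]
  · intro t
    rw [hud]
    obtain ⟨s, hs⟩ := hxN t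
    exact mem_iUnion.2 ⟨s, by rwa [mem_ball, dist_eq_norm]⟩
  · rintro τ' w hτ' hw ⟨hτ'0, hwper, -⟩ ⟨t₀, ht₀⟩
    obtain ⟨-, hτ'2, hτ'T⟩ := hperiod _ hτ'
    obtain ⟨s, hs⟩ := mem_iUnion.1 ht₀
    rw [mem_ball, dist_eq_norm] at hs
    set W : ℝ → ℝ × ℝ := fun t => (w (t₀ + t), deriv w (t₀ + t)) with hWdef
    have hWtrue : ∀ t,
        HasDerivAt W (forcedLienardField f g (fun u v => ε * γ u v ε τ') (W t)) t := fun t =>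
      hasDerivAt_comp_add_solution hw.hasDerivAt t₀ t
    have hWper : Periodic W τ' := fun t => by
      simp only [hWdef, ← add_assoc]
      rw [hwper, hwper.deriv']
    have hW0 : ‖W 0 - x₀ s‖ < δ₂ := by simpa [hWdef] using hs
    -- the solution of the truncated equation with the same initial value follows the orbit, and
    -- therefore equals `W` for two periods
    obtain ⟨y, hy0, hy⟩ := hO.family.exists_solution hε1 τ' (W 0)
    have hytube : ∀ t ∈ Icc 0 (2 * τ₀), ‖y t - x₀ (s + t)‖ < δ := by
      intro t ht
      refine (hnear ε τ' s y hy t ht).trans_lt ?_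
      rw [hy0]
      have : G * (‖W 0 - x₀ s‖ + |ε|) ≤ G * (δ₂ + δ₂) := by
        have := hε.trans hε₀δ
        gcongr
      nlinarith
    have hWy : EqOn W y (Icc 0 (2 * τ₀)) := by
      refine solution_unique_of_mem_phaseDisc (contDiffOn_forcedLienardField
        (hf.of_le (by norm_num)) (hg.of_le (by norm_num)) (hγ.of_le (by norm_num))
        (ε := ε) (τ := τ') (by linarith) (by linarith)) (fun t _ => hWtrue t) (fun t ht => ?_)
        (fun t _ => hw.mem _) (fun t ht => hdisc _ _ (hytube t ht)) hy0.symm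
      rw [← hX ε τ' (s + t) (y t) hεe hτ'T (hytube t ht)]
      exact hy t
    have hWtube : ∀ t, ∃ s, ‖W t - x₀ s‖ < δ :=
      hWper.forall_of_forall_Icc hτ'0 hτ'2 (p := fun y => ∃ s, ‖y - x₀ s‖ < δ) fun t ht => by
        rw [hWy ht]
        exact ⟨_, hytube t ht⟩
    have hWX : ∀ t, HasDerivAt W (X ε τ' (W t)) t := by
      intro t
      obtain ⟨s', hs'⟩ := hWtube t
      rw [hX ε τ' s' (W t) hεe hτ'T hs']
      exact hWtrue t
    obtain ⟨t₁, ht₁, ht₁a⟩ := hcross ε τ' s W (hε.trans (hε₀δ.trans (min_le_left _ _)))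
      (hW0.le.trans (min_le_left _ _)) hWX
    have hWt₁ : W (t₁ + 0) = (a + ((W t₁).1 - a), 0) := by
      rw [add_zero]
      ext <;> simp [ht₁]
    obtain ⟨hξ, hτeq⟩ := huniq ε _ (h ε) τ' (τ ε) (fun t => W (t₁ + t)) (x ε)
      ((hε.trans hε₀ρ).trans hρ'ρ) ht₁a ((hh ε hε).trans hρ'ρ) (hτ'.le.trans hτ₁ρ)
      (hτε.le.trans hτ₁ρ) hWt₁ (hx0 ε hε) (hasDerivAt_comp_add_solution hWX t₁) (hx ε hε)
      (by simpa using hWper t₁) (hxτ ε hε)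
    subst hτeq
    have hWx : (fun t => W (t₁ + t)) = x ε :=
      hL.solution_unique (hasDerivAt_comp_add_solution hWX t₁) (hx ε hε) (t₀ := 0)
        (by rw [hWt₁, hξ, hx0 ε hε])
    refine ⟨rfl, -t₁ - t₀, fun t => ?_⟩
    rw [← hWx]
    simp only [hWdef]
    congr 1
    ring
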